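/- Conventions. A Banach analytic manifold is a connected topological space in which each point has a neighbourhood homeomorphic to an open subset of a complex Banach space, with holomorphic transition maps. For Banach analytic manifolds $A,X$, $\mathrm{Hol}(A,X)$ is the space of holomorphic maps $A\to X$ with the compact-open topology. For $S\subset A$, let $S^u$ be the set of $z\in\overline S$ such that for every connected open neighbourhood $U$ of $z$, every holomorphic $f:U\to\mathbb C$ with $f|_{U\cap S}=0$ vanishes identically on $U$. For a sequence $\{f_k\}$ of holomorphic maps from $A$ to $X$, $Z_{\{f_k\}}$ is the set of $\lambda\in A$ such that $\{f_k(\lambda)\}$ converges. $X$ has the weak Vitali property (WVP) if for every Banach analytic manifold $A$, every sequence $\{f_k\}\subset\mathrm{Hol}(A,X)$ with $Z_{\{f_k\}}\cap Z_{\{f_k\}}^u\neq\emptyset$ converges in $\mathrm{Hol}(A,X)$. An open set $\Omega\subset X$ has the quasi weak Vitali property (QWVP) if for every Banach analytic manifold $A$, every sequence $\{f_k\}\subset\mathrm{Hol}(A,\Omega)$ with $Z_{\{f_k\}}\cap Z_{\{f_k\}}^u\neq\emptyset$ converges in $\mathrm{Hol}(A,X)$. $X$ is hyperbolic if its Kobayashi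 pseudo-distance (the infimum of the lengths of chains of holomorphic disks, measured by the Poincaré distance) is a distance and defines the topology of $X$. A function $\varphi:X\to[-\infty,\infty)$ is plurisubharmonic if each point of $X$ has a neighbourhood isomorphic to a ball in a Banach space on which $\varphi$ is upper semicontinuous and is subharmonic on the intersection of the ball with each complex line (the value $-\infty$ is allowed, even identically). Theorem 4.1. Let $X$ be a Banach analytic manifold and let $\varphi$ be a plurisubharmonic function on $X$ with $\varphi<0$ everywhere. Then the following are equivalent: (i) $X$ is hyperbolic, and for every $c<0$ the sublevel set $X_c=\{z\in X:\varphi(z)<c\}$ has QWVP; (ii) $X$ has WVP. This holds both when, in the definition of QWVP of $X_c$, the set $Z_{\{f_k\}}$ is defined by convergence of $\{f_k(\lambda)\}$ in $X_c$ and when it is defined by convergence in $X$. -/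

import Mathlib

open scoped Manifold ContDiff Topology

noncomputable section

/-! A Banach analytic manifold is a connected space `X` with
`[ChartedSpace E X] [IsManifold 𝓘(ℂ, E) ω X] [ConnectedSpace X]`, where `E` is a complex Banach
space. (On a connected manifold all local model spaces are isomorphic, so one model suffices.)
Holomorphic means complex Fréchet differentiable in charts. No separation axiom is imposed. -/

/-- `Hol E F A X`: the holomorphic maps from `A` (modelled on `E`) to `X` (modelled on `F`), as a
subspace of `C(A, X)`; its topology is therefore the compact-open topology. -/
abbrev Hol (E F A X : Type*)
    [NormedAddCommGroup E] [NormedSpace ℂ E] [NormedAddCommGroup F] [NormedSpace ℂ F]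
    [TopologicalSpace A] [ChartedSpace E A] [TopologicalSpace X] [ChartedSpace F X] : Type _ :=
  {f : C(A, X) // MDifferentiable 𝓘(ℂ, E) 𝓘(ℂ, F) f}

/-- The set `Sᵘ` of the points `z` of the closure of `S` such that on every connected open
neighbourhood `U` of `z`, a holomorphic function vanishing on `U ∩ S` vanishes on `U`. -/
def uniquenessPoints (E : Type*) {A : Type*} [NormedAddCommGroup E] [NormedSpace ℂ E]
    [TopologicalSpace A] [ChartedSpace E A] (S : Set A) : Set A :=
  {z | z ∈ closure S ∧ ∀ U : Set A, IsOpen U → IsConnected U → z ∈ U →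
    ∀ f : A → ℂ, MDifferentiableOn 𝓘(ℂ, E) 𝓘(ℂ, ℂ) f U →
      (∀ x ∈ U ∩ S, f x = 0) → ∀ x ∈ U, f x = 0}

/-- The set of points `a` at which the sequence `f k a` converges to some point of `T`. -/
def convergenceSet {A X : Type*} [TopologicalSpace X] (f : ℕ → A → X) (T : Set X) : Set A :=
  {a | ∃ x ∈ T, Filter.Tendsto (fun k => f k a) Filter.atTop (𝓝 x)}

/-- The weak Vitali property of `X`: for every connected Banach analytic manifold `A`, every
sequence in `Hol(A, X)` with `Z ∩ Zᵘ ≠ ∅`, where `Z` is the set of points of pointwise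
convergence, converges in `Hol(A, X)`. -/
def HasWVP.{w, u, v} (E : Type u) (X : Type v) [NormedAddCommGroup E] [NormedSpace ℂ E]
    [TopologicalSpace X] [ChartedSpace E X] : Prop :=
  ∀ (F A : Type w) [NormedAddCommGroup F] [NormedSpace ℂ F] [CompleteSpace F]
    [TopologicalSpace A] [ChartedSpace F A] [IsManifold 𝓘(ℂ, F) ω A] [ConnectedSpace A]
    (f : ℕ → Hol F E A X),
    (convergenceSet (fun k => ⇑(f k).1) Set.univ ∩
      uniquenessPoints F (convergenceSet (fun k => ⇑(f k).1) Set.univ)).Nonempty →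
    ∃ g : Hol F E A X, Filter.Tendsto f Filter.atTop (𝓝 g)

/-- The quasi weak Vitali property of an open set `Ω ⊆ X`: for every connected Banach analytic
manifold `A`, every sequence of holomorphic maps from `A` to `Ω` with `Z ∩ Zᵘ ≠ ∅` converges in
`Hol(A, X)`. Here `Z` is the set of points at which the sequence converges to a point of `T`;
the relevant choices are `T = Ω` (convergence in `Ω`) and `T = univ` (convergence in `X`). -/
def HasQuasiWVP.{w, u, v} (E : Type u) {X : Type v} [NormedAddCommGroup E] [NormedSpace ℂ E]
    [TopologicalSpace X] [ChartedSpace E X] (Ω T : Set X) : Prop :=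
  ∀ (F A : Type w) [NormedAddCommGroup F] [NormedSpace ℂ F] [CompleteSpace F]
    [TopologicalSpace A] [ChartedSpace F A] [IsManifold 𝓘(ℂ, F) ω A] [ConnectedSpace A]
    (f : ℕ → Hol F E A X),
    (∀ k a, (f k).1 a ∈ Ω) →
    (convergenceSet (fun k => ⇑(f k).1) T ∩
      uniquenessPoints F (convergenceSet (fun k => ⇑(f k).1) T)).Nonempty →
    ∃ g : Hol F E A X, Filter.Tendsto f Filter.atTop (𝓝 g)

/-- The Poincaré distance on the unit disk. -/
def poincareDist (a b : ℂ) : ℝ :=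
  let m := ‖(a - b) / (1 - (starRingEnd ℂ) a * b)‖
  Real.log ((1 + m) / (1 - m))

/-- `HolChain E p q l`: there is a chain of holomorphic disks in `X` from `p` to `q` of total
length `l`. Each link is a holomorphic map `f` of the unit disk into `X` (only its values on the
disk matter) with two points `a`, `b` of the disk, and contributes `poincareDist a b`. -/
inductive HolChain (E : Type*) {X : Type*} [NormedAddCommGroup E] [NormedSpace ℂ E]
    [TopologicalSpace X] [ChartedSpace E X] : X → X → ℝ → Prop
  | nil (p : X) : HolChain E p p 0
  | cons (f : ℂ → X) (a b : ℂ) (q : X) (l : ℝ)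
      (hf : MDifferentiableOn 𝓘(ℂ, ℂ) 𝓘(ℂ, E) f (Metric.ball 0 1))
      (ha : a ∈ Metric.ball (0 : ℂ) 1) (hb : b ∈ Metric.ball (0 : ℂ) 1)
      (h : HolChain E (f b) q l) : HolChain E (f a) q (poincareDist a b + l)

/-- The Kobayashi pseudo-distance: the infimum of the lengths of holomorphic chains. -/
def kobayashiDist (E : Type*) {X : Type*} [NormedAddCommGroup E] [NormedSpace ℂ E]
    [TopologicalSpace X] [ChartedSpace E X] (p q : X) : ENNReal :=
  ⨅ (l : ℝ) (_ : HolChain E p q l), ENNReal.ofReal l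

/-- `X` is hyperbolic: the Kobayashi pseudo-distance is a (finite, separating) distance and
defines the topology of `X`. -/
def IsHyperbolic (E X : Type*) [NormedAddCommGroup E] [NormedSpace ℂ E]
    [TopologicalSpace X] [ChartedSpace E X] : Prop :=
  (∀ p q : X, kobayashiDist E p q ≠ ⊤) ∧
  (∀ p q : X, kobayashiDist E p q = 0 → p = q) ∧
  ∀ s : Set X, IsOpen s ↔
    ∀ x ∈ s, ∃ ε : ENNReal, 0 < ε ∧ ∀ y : X, kobayashiDist E x y < ε → y ∈ s

/-- The mean over a circle of an upper semicontinuous function with values in `[-∞, ∞)`: the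
limit of the means of the bounded functions `max u (-N)`, which decrease to `u` (by monotone
convergence this is the usual integral mean, possibly `-∞`). -/
def circleMean (u : ℂ → EReal) (c : ℂ) (r : ℝ) : EReal :=
  ⨅ N : ℕ, ((Real.circleAverage (fun z => (max (u z) ((-(N : ℝ) : ℝ) : EReal)).toReal) c r : ℝ) :
    EReal)

/-- Subharmonic functions `D → [-∞, ∞)` on an open set `D ⊆ ℂ` (`-∞` identically is allowed):
upper semicontinuous with the sub-mean value property. -/
def IsSubharmonicOn (u : ℂ → EReal) (D : Set ℂ) : Prop :=
  (∀ z ∈ D, u z < ⊤) ∧ UpperSemicontinuousOn u D ∧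
  ∀ (c : ℂ) (r : ℝ), 0 < r → Metric.closedBall c r ⊆ D → u c ≤ circleMean u c r

/-- Plurisubharmonic functions `B → [-∞, ∞)` on an open set `B` of a normed space: upper
semicontinuous and subharmonic on the intersection of `B` with each complex line. -/
def IsPshOn {E : Type*} [NormedAddCommGroup E] [NormedSpace ℂ E] (u : E → EReal) (B : Set E) :
    Prop :=
  (∀ x ∈ B, u x < ⊤) ∧ UpperSemicontinuousOn u B ∧
  ∀ x v : E, IsSubharmonicOn (fun ζ : ℂ => u (x + ζ • v)) {ζ : ℂ | x + ζ • v ∈ B}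

/-- Plurisubharmonic functions on a Banach analytic manifold: each point has a neighbourhood
which a chart of the maximal holomorphic atlas identifies with a ball, on which the function is
plurisubharmonic. -/
def IsPlurisubharmonic (E : Type*) {X : Type*} [NormedAddCommGroup E] [NormedSpace ℂ E]
    [TopologicalSpace X] [ChartedSpace E X] (φ : X → EReal) : Prop :=
  ∀ a : X, ∃ e ∈ IsManifold.maximalAtlas 𝓘(ℂ, E) ω X, a ∈ e.source ∧
    ∃ (c : E) (r : ℝ), e.target = Metric.ball c r ∧ IsPshOn (fun y => φ (e.symm y)) e.target

end

universe u v w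

/-! ### The Poincaré distance -/

section Disk

open Metric Complex

/-! WVP implies QWVP at once, since restricting the limits only shrinks `Z`. For hyperbolicity, the
main point is `HasWVP.exists_radius`. If disks `f k` centred ever closer to `x` left a neighbourhood
of `x` at points `z k` tending fast to `0`, precompose them with polynomials that vanish at `0`,
`1/3`, `1/4`, … and take the value `z k` at `1/2`. Interleaved with the constant `x`, they converge
at all these nodes, which accumulate at `0`, hence everywhere by WVP. The limit at `1/2` must be
`x`, a contradiction. The Schwarz lemma then makes a chart at `x` Lipschitz along short chains of
disks, so Kobayashi balls shrink to `x`.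

Conversely, on a hyperbolic manifold holomorphic maps decrease the Kobayashi distance, so a sequence
of them is equicontinuous at each point of convergence (`IsHyperbolic.exists_nhds_eventually_mem`).
Near such a point almost all maps take values in one sublevel set with `c < 0`, so QWVP gives an
open set of convergence. To see that the interior of `Z` is closed, pass from a point `p` of it to
nearby points `b` along complex disks: a two constants theorem turns `φ ∘ f k ≤ c` near `p` into a
uniform negative bound at `b`, and QWVP applies on a neighbourhood of the boundary point.

The two constants theorem needs `φ` to be subharmonic along holomorphic curves, while the definition
speaks only of complex lines. It is enough to have this in the viscosity sense: `IsPshOn.not_touch`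
excludes contact from above with strictly superharmonic quadratics. The curve is approximated by a
polynomial one, which lies in a finite-dimensional affine subspace; there a convolution makes the
function `C¹` and keeps its sub-mean value property. -/

lemma norm_sub_lt_norm_one_sub_conj_mul {a b : ℂ} (ha : ‖a‖ < 1) (hb : ‖b‖ < 1) :
    ‖a - b‖ < ‖1 - (starRingEnd ℂ) a * b‖ := by
  have key : ‖1 - (starRingEnd ℂ) a * b‖ ^ 2 - ‖a - b‖ ^ 2 = (1 - ‖a‖ ^ 2) * (1 - ‖b‖ ^ 2) := by
    simp only [Complex.sq_norm, Complex.normSq_apply, sub_re, sub_im, one_re, one_im, mul_re,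
      mul_im, conj_re, conj_im]
    ring
  have h1 : 0 < 1 - ‖a‖ ^ 2 := by nlinarith [norm_nonneg a]
  have h2 : 0 < 1 - ‖b‖ ^ 2 := by nlinarith [norm_nonneg b]
  have := mul_pos h1 h2
  exact lt_of_pow_lt_pow_left₀ 2 (norm_nonneg _) (by linarith)

lemma one_sub_conj_mul_ne_zero {a b : ℂ} (ha : ‖a‖ < 1) (hb : ‖b‖ < 1) :
    1 - (starRingEnd ℂ) a * b ≠ 0 :=
  norm_pos_iff.1 ((norm_nonneg _).trans_lt (norm_sub_lt_norm_one_sub_conj_mul ha hb))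

/-- The involutive automorphism of the unit disk exchanging `0` and `a`. -/
noncomputable def diskInvolution (a ζ : ℂ) : ℂ := (a - ζ) / (1 - (starRingEnd ℂ) a * ζ)

lemma diskInvolution_zero (a : ℂ) : diskInvolution a 0 = a := by simp [diskInvolution]

lemma norm_diskInvolution_lt_one {a b : ℂ} (ha : ‖a‖ < 1) (hb : ‖b‖ < 1) :
    ‖diskInvolution a b‖ < 1 := by
  rw [diskInvolution, norm_div, div_lt_one (norm_pos_iff.2 (one_sub_conj_mul_ne_zero ha hb))]
  exact norm_sub_lt_norm_one_sub_conj_mul ha hb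

lemma diskInvolution_diskInvolution {a b : ℂ} (ha : ‖a‖ < 1) (hb : ‖b‖ < 1) :
    diskInvolution a (diskInvolution a b) = b := by
  have h := one_sub_conj_mul_ne_zero ha hb
  have h' := one_sub_conj_mul_ne_zero ha (norm_diskInvolution_lt_one ha hb)
  have h2 : diskInvolution a b * (1 - (starRingEnd ℂ) a * b) = a - b := div_mul_cancel₀ _ h
  rw [diskInvolution, div_eq_iff h']
  have : (a - diskInvolution a b - b * (1 - (starRingEnd ℂ) a * diskInvolution a b)) *
      (1 - (starRingEnd ℂ) a * b) = 0 := by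
    linear_combination (-1 + b * (starRingEnd ℂ) a) * h2
  have := (mul_eq_zero.1 this).resolve_right h
  linear_combination this

lemma differentiableOn_diskInvolution {a : ℂ} (ha : ‖a‖ < 1) :
    DifferentiableOn ℂ (diskInvolution a) (ball 0 1) := by
  intro z hz
  have hz' : ‖z‖ < 1 := by simpa using hz
  have : DifferentiableAt ℂ (fun ζ => (a - ζ) / (1 - (starRingEnd ℂ) a * ζ)) z :=
    DifferentiableAt.div (by fun_prop) (by fun_prop) (one_sub_conj_mul_ne_zero ha hz')
  exact this.differentiableWithinAt

/-- Apply `log x ≥ 1 - 1/x` at `x = (1 + m)/(1 - m)`: the right side is `2m/(1 + m) ≥ m`. This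
linear bound is all that the Schwarz estimate needs. -/
lemma norm_diskInvolution_le_poincareDist {a b : ℂ} (ha : ‖a‖ < 1) (hb : ‖b‖ < 1) :
    ‖diskInvolution a b‖ ≤ poincareDist a b := by
  have h1 := norm_diskInvolution_lt_one ha hb
  have h0 := norm_nonneg (diskInvolution a b)
  unfold poincareDist
  change _ ≤ Real.log ((1 + ‖diskInvolution a b‖) / (1 - ‖diskInvolution a b‖))
  set m := ‖diskInvolution a b‖
  have hm : 0 < 1 - m := by linarith
  have h2 := Real.one_sub_inv_le_log_of_pos (x := (1 + m) / (1 - m)) (by positivity)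
  rw [inv_div] at h2
  refine le_trans ?_ h2
  rw [le_sub_iff_add_le, ← le_sub_iff_add_le', div_le_iff₀ (by linarith)]
  nlinarith

lemma poincareDist_nonneg {a b : ℂ} (ha : ‖a‖ < 1) (hb : ‖b‖ < 1) : 0 ≤ poincareDist a b :=
  (norm_nonneg _).trans (norm_diskInvolution_le_poincareDist ha hb)

lemma poincareDist_comm (a b : ℂ) : poincareDist a b = poincareDist b a := by
  have : ‖(a - b) / (1 - (starRingEnd ℂ) a * b)‖ = ‖(b - a) / (1 - (starRingEnd ℂ) b * a)‖ := by
    rw [norm_div, norm_div, norm_sub_rev a b]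
    congr 1
    rw [← Complex.norm_conj (1 - (starRingEnd ℂ) a * b)]
    simp [mul_comm]
  simp only [poincareDist, this]

lemma tendsto_poincareDist_zero :
    Filter.Tendsto (fun t : ℝ => poincareDist 0 (t : ℂ)) (𝓝 0) (𝓝 0) := by
  have h : ∀ t : ℝ, poincareDist 0 (t : ℂ) = Real.log ((1 + |t|) / (1 - |t|)) := by
    intro t; simp [poincareDist]
  simp only [h]
  have : ContinuousAt (fun t : ℝ => Real.log ((1 + |t|) / (1 - |t|))) 0 := by
    refine ContinuousAt.log (ContinuousAt.div (by fun_prop) (by fun_prop) (by simp)) (by simp)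
  simpa [ContinuousAt] using this

end Disk

/-! ### Chains of holomorphic disks and the Kobayashi pseudo-distance -/

section Kobayashi

open Metric

variable {E : Type*} {X : Type*} [NormedAddCommGroup E] [NormedSpace ℂ E]
  [TopologicalSpace X] [ChartedSpace E X]

lemma HolChain.length_nonneg {p q : X} {l : ℝ} (h : HolChain E p q l) : 0 ≤ l := by
  induction h with
  | nil => exact le_rfl
  | cons f a b q l hf ha hb h ih =>
    exact add_nonneg (poincareDist_nonneg (by simpa using ha) (by simpa using hb)) ih

lemma HolChain.trans {p q r : X} {l m : ℝ} (h : HolChain E p q l) (h' : HolChain E q r m) :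
    HolChain E p r (l + m) := by
  induction h with
  | nil => simpa using h'
  | cons f a b q l hf ha hb h ih =>
    rw [add_assoc]
    exact HolChain.cons f a b r (l + m) hf ha hb (ih h')

lemma HolChain.single {f : ℂ → X} {a b : ℂ}
    (hf : MDifferentiableOn 𝓘(ℂ, ℂ) 𝓘(ℂ, E) f (ball 0 1))
    (ha : a ∈ ball (0 : ℂ) 1) (hb : b ∈ ball (0 : ℂ) 1) :
    HolChain E (f a) (f b) (poincareDist a b) := by
  simpa using HolChain.cons f a b (f b) 0 hf ha hb (HolChain.nil _)

lemma HolChain.symm {p q : X} {l : ℝ} (h : HolChain E p q l) : HolChain E q p l := by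
  induction h with
  | nil => exact HolChain.nil _
  | cons f a b q l hf ha hb h ih =>
    rw [add_comm, poincareDist_comm]
    exact ih.trans (HolChain.single hf hb ha)

lemma HolChain.map {F Y : Type*} [NormedAddCommGroup F] [NormedSpace ℂ F]
    [TopologicalSpace Y] [ChartedSpace F Y] {g : X → Y} (hg : MDifferentiable 𝓘(ℂ, E) 𝓘(ℂ, F) g)
    {p q : X} {l : ℝ} (h : HolChain E p q l) : HolChain F (g p) (g q) l := by
  induction h with
  | nil => exact HolChain.nil _
  | cons f a b q l hf ha hb h ih =>
    exact HolChain.cons (g ∘ f) a b (g q) l (hg.comp_mdifferentiableOn hf) ha hb ih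

lemma kobayashiDist_le_of_holChain {p q : X} {l : ℝ} (h : HolChain E p q l) :
    kobayashiDist E p q ≤ ENNReal.ofReal l := iInf₂_le l h

lemma kobayashiDist_lt_iff {p q : X} {c : ENNReal} :
    kobayashiDist E p q < c ↔ ∃ l, HolChain E p q l ∧ ENNReal.ofReal l < c := by
  simp [kobayashiDist, iInf_lt_iff]

lemma kobayashiDist_comm (p q : X) : kobayashiDist E p q = kobayashiDist E q p :=
  le_antisymm (le_iInf₂ fun _ h => kobayashiDist_le_of_holChain h.symm)
    (le_iInf₂ fun _ h => kobayashiDist_le_of_holChain h.symm)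

lemma kobayashiDist_triangle_lt {p q r : X} {c d : ENNReal} (h : kobayashiDist E p q < c)
    (h' : kobayashiDist E q r < d) : kobayashiDist E p r < c + d := by
  obtain ⟨l, hl, hlc⟩ := kobayashiDist_lt_iff.1 h
  obtain ⟨m, hm, hmd⟩ := kobayashiDist_lt_iff.1 h'
  refine (kobayashiDist_le_of_holChain (hl.trans hm)).trans_lt ?_
  exact ENNReal.ofReal_add_le.trans_lt (ENNReal.add_lt_add hlc hmd)

lemma kobayashiDist_map_le {F Y : Type*} [NormedAddCommGroup F] [NormedSpace ℂ F]
    [TopologicalSpace Y] [ChartedSpace F Y] {g : X → Y} (hg : MDifferentiable 𝓘(ℂ, E) 𝓘(ℂ, F) g)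
    (p q : X) : kobayashiDist F (g p) (g q) ≤ kobayashiDist E p q :=
  le_iInf₂ fun _ h => kobayashiDist_le_of_holChain (h.map hg)

variable [IsManifold 𝓘(ℂ, E) ω X]

/-- Points close to `x` are joined to `x` by a single short disk. -/
lemma eventually_holChain_lt (x : X) {ε : ℝ} (hε : 0 < ε) :
    ∃ l < ε, ∀ᶠ y in 𝓝 x, HolChain E x y l := by
  obtain ⟨R, hR, hball⟩ := Metric.isOpen_iff.1 (chartAt E x).open_target _ (mem_chart_target E x)
  obtain ⟨t, ⟨ht0, ht1⟩, htε⟩ : ∃ t : ℝ, (0 < t ∧ t < 1) ∧ poincareDist 0 (t : ℂ) < ε := by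
    have h1 : ∀ᶠ t : ℝ in 𝓝[>] 0, poincareDist 0 (t : ℂ) < ε :=
      (tendsto_poincareDist_zero.mono_left nhdsWithin_le_nhds).eventually (gt_mem_nhds hε)
    have h2 : ∀ᶠ t : ℝ in 𝓝[>] 0, t ∈ Set.Ioo (0 : ℝ) 1 := Ioo_mem_nhdsGT one_pos
    obtain ⟨t, h1, h2⟩ := (h1.and h2).exists
    exact ⟨t, h2, h1⟩
  refine ⟨_, htε, ?_⟩
  have hc := (chartAt E x).continuousAt (mem_chart_source E x)
  filter_upwards [hc.eventually (ball_mem_nhds _ (mul_pos ht0 hR)),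
    (chartAt E x).open_source.mem_nhds (mem_chart_source E x)] with y hy hys
  set e := chartAt E x
  set v := e y - e x
  have hv : ‖v‖ < t * R := by simpa [dist_eq_norm] using hy
  -- This disk takes `0` to `e x` and `t` to `e y`, and `‖v‖ < t * R` keeps it in the ball of radius
  -- `R`. Since `t` does not depend on `y`, neither does the length.
  let g : ℂ → E := fun ζ => e x + (ζ * (t : ℂ)⁻¹) • v
  have hmaps : ∀ ζ ∈ ball (0 : ℂ) 1, g ζ ∈ e.target := by
    intro ζ hζ
    apply hball
    have hζ' : ‖ζ‖ < 1 := by simpa using hζ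
    have : ‖ζ‖ * (t⁻¹ * ‖v‖) ≤ t⁻¹ * ‖v‖ :=
      mul_le_of_le_one_left (by positivity) hζ'.le
    have h3 : t⁻¹ * ‖v‖ < R := by rwa [inv_mul_lt_iff₀ ht0]
    simp only [g, mem_ball, dist_self_add_left, norm_smul, norm_mul, norm_inv,
      Complex.norm_real, Real.norm_eq_abs, abs_of_pos ht0]
    linarith
  have hg : MDifferentiableOn 𝓘(ℂ, ℂ) 𝓘(ℂ, E) g (ball 0 1) := by
    rw [mdifferentiableOn_iff_differentiableOn]; fun_prop
  have hf := (mdifferentiableOn_atlas_symm (I := 𝓘(ℂ, E)) (chart_mem_atlas E x)).comp hg hmaps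
  have := HolChain.single hf (a := 0) (b := t) (by simp) (by simpa [abs_of_pos ht0] using ht1)
  have ht : (t : ℂ) ≠ 0 := by exact_mod_cast ht0.ne'
  have e1 : (e.symm ∘ g) 0 = x := by simp [g, e]
  have e2 : (e.symm ∘ g) t = y := by simp [g, ht, v, e.left_inv hys]
  rw [e1, e2] at this
  exact this

lemma eventually_kobayashiDist_lt (x : X) {ε : ENNReal} (hε : 0 < ε) :
    ∀ᶠ y in 𝓝 x, kobayashiDist E x y < ε := by
  obtain ⟨δ, hδ, hδε⟩ := ENNReal.lt_iff_exists_real_btwn.1 hε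
  have hδ0 : 0 < δ := ENNReal.ofReal_pos.1 hδε.1
  obtain ⟨l, hl, h⟩ := eventually_holChain_lt (E := E) x hδ0
  filter_upwards [h] with y hy
  exact (kobayashiDist_le_of_holChain hy).trans_lt
    ((ENNReal.ofReal_le_ofReal hl.le).trans_lt hδε.2)

/-- The points joined to `p` by a chain form a clopen set, because nearby points are joined by one
disk. -/
lemma kobayashiDist_ne_top [ConnectedSpace X] (p q : X) : kobayashiDist E p q ≠ ⊤ := by
  let s : Set X := {q | ∃ l, HolChain E p q l}
  have hs : IsClopen s := by
    constructor
    · rw [isClosed_iff_frequently]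
      intro x hx
      obtain ⟨l, -, h⟩ := eventually_holChain_lt (E := E) x one_pos
      obtain ⟨y, ⟨m, hm⟩, hy⟩ := (hx.and_eventually h).exists
      exact ⟨_, hm.trans hy.symm⟩
    · rw [isOpen_iff_mem_nhds]
      rintro x ⟨m, hm⟩
      obtain ⟨l, -, h⟩ := eventually_holChain_lt (E := E) x one_pos
      filter_upwards [h] with y hy
      exact ⟨_, hm.trans hy⟩
  have : q ∈ s := by
    rw [hs.eq_univ ⟨p, 0, HolChain.nil p⟩]; trivial
  obtain ⟨l, hl⟩ := this
  exact ((kobayashiDist_le_of_holChain hl).trans_lt ENNReal.ofReal_lt_top).ne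

/-- The half of "the distance defines the topology" that holds on every manifold: the
pseudo-distance to `x` tends to `0` at `x`. -/
lemma isOpen_of_forall_kobayashiDist_lt {s : Set X}
    (h : ∀ x ∈ s, ∃ ε : ENNReal, 0 < ε ∧ ∀ y : X, kobayashiDist E x y < ε → y ∈ s) :
    IsOpen s := by
  rw [isOpen_iff_mem_nhds]
  intro x hx
  obtain ⟨ε, hε, hs⟩ := h x hx
  filter_upwards [eventually_kobayashiDist_lt (E := E) x hε] with y hy using hs y hy

lemma IsHyperbolic.t2Space (hX : IsHyperbolic E X) : T2Space X := by
  refine ⟨fun p q hpq => ?_⟩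
  have hd : 0 < kobayashiDist E p q := by
    rw [pos_iff_ne_zero]; exact fun h => hpq (hX.2.1 p q h)
  have h2 : 0 < kobayashiDist E p q / 2 := ENNReal.half_pos hd.ne'
  obtain ⟨u, hu, huo, hpu⟩ := mem_nhds_iff.1 (eventually_kobayashiDist_lt (E := E) p h2)
  obtain ⟨v, hv, hvo, hqv⟩ := mem_nhds_iff.1 (eventually_kobayashiDist_lt (E := E) q h2)
  refine ⟨u, v, huo, hvo, hpu, hqv, Set.disjoint_left.2 fun y hyu hyv => ?_⟩
  have h3 : kobayashiDist E y q < _ := (kobayashiDist_comm (E := E) y q).trans_lt (hv hyv)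
  have := kobayashiDist_triangle_lt (hu hyu) h3
  rw [ENNReal.add_halves] at this
  exact this.false

/-- On a hyperbolic manifold, sequences of holomorphic maps are equicontinuous. -/
lemma IsHyperbolic.exists_nhds_eventually_mem (hX : IsHyperbolic E X) {F A : Type*}
    [NormedAddCommGroup F] [NormedSpace ℂ F] [TopologicalSpace A] [ChartedSpace F A]
    [IsManifold 𝓘(ℂ, F) ω A] {f : ℕ → A → X} (hf : ∀ k, MDifferentiable 𝓘(ℂ, F) 𝓘(ℂ, E) (f k))
    {a : A} {x : X} (hx : Filter.Tendsto (fun k => f k a) Filter.atTop (𝓝 x))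
    {U : Set X} (hU : IsOpen U) (hxU : x ∈ U) :
    ∃ W ∈ 𝓝 a, (∀ᶠ k in Filter.atTop, ∀ b ∈ W, f k b ∈ U) ∧
      ∀ b ∈ W, ∀ y, Filter.Tendsto (fun k => f k b) Filter.atTop (𝓝 y) → y ∈ U := by
  obtain ⟨ε, hε, hεU⟩ := (hX.2.2 U).1 hU x hxU
  have hε3 : 0 < ε / 3 := ENNReal.div_pos hε.ne' (by simp)
  -- Two thirds of `ε` suffice for `f k b`; the last third puts pointwise limits in `U` itself and
  -- not only in its closure.
  have key : ∀ᶠ k in Filter.atTop, ∀ b, kobayashiDist F a b < ε / 3 →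
      kobayashiDist E x (f k b) < ε / 3 + ε / 3 := by
    filter_upwards [hx.eventually (eventually_kobayashiDist_lt (E := E) x hε3)] with k hk b hb
    exact kobayashiDist_triangle_lt hk ((kobayashiDist_map_le (hf k) a b).trans_lt hb)
  have hsum : ε / 3 + ε / 3 + ε / 3 = ε := ENNReal.add_thirds ε
  refine ⟨_, eventually_kobayashiDist_lt (E := F) a hε3, ?_, ?_⟩
  · filter_upwards [key] with k hk b hb
    exact hεU _ ((hk b hb).trans_le (le_self_add.trans hsum.le))
  · intro b hb y hy
    obtain ⟨k, hk, hky⟩ := (key.and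
      (hy.eventually (eventually_kobayashiDist_lt (E := E) y hε3))).exists
    rw [kobayashiDist_comm] at hky
    refine hεU _ ?_
    have := kobayashiDist_triangle_lt (hk b hb) hky
    rwa [hsum] at this

end Kobayashi

/-! ### Uniqueness points -/

section Uniqueness

variable {F A : Type*} [NormedAddCommGroup F] [NormedSpace ℂ F]
  [TopologicalSpace A] [ChartedSpace F A]

lemma uniquenessPoints_mono {S T : Set A} (h : S ⊆ T) :
    uniquenessPoints F S ⊆ uniquenessPoints F T := fun _ hz =>
  ⟨closure_mono h hz.1, fun U hU hUc hzU f hf h0 =>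
    hz.2 U hU hUc hzU f hf fun x hx => h0 x ⟨hx.1, h hx.2⟩⟩

lemma mdifferentiableAt_opens_iff {E X : Type*} [NormedAddCommGroup E] [NormedSpace ℂ E]
    [TopologicalSpace X] [ChartedSpace E X] {V : TopologicalSpace.Opens A} {f : A → X} {x : V} :
    MDifferentiableAt 𝓘(ℂ, F) 𝓘(ℂ, E) (fun y : V => f y) x ↔
      MDifferentiableAt 𝓘(ℂ, F) 𝓘(ℂ, E) f x :=
  (differentiableWithinAt_localInvariantProp.liftPropAt_iff_comp_subtype_val _ _).symm

/-- Uniqueness points are a local notion: a test function on an open subset of `V` extends by zero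
to `A` and stays holomorphic on the image of that open subset. -/
lemma mem_uniquenessPoints_opens {V : TopologicalSpace.Opens A} {S : Set A} {p : V}
    (hp : (p : A) ∈ uniquenessPoints F S) :
    p ∈ uniquenessPoints F ((↑) ⁻¹' S : Set V) := by
  refine ⟨?_, fun U hU hUc hpU f hf h0 x hx => ?_⟩
  · rw [← V.isOpenEmbedding'.isOpenMap.preimage_closure_eq_closure_preimage
      V.isOpenEmbedding'.continuous]
    exact hp.1
  · let G : A → ℂ := Function.extend (Subtype.val : V → A) f 0
    have hG : ∀ y : V, G y = f y := fun y => Subtype.val_injective.extend_apply f 0 y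
    have hUo : IsOpen (Subtype.val '' U) := V.isOpenEmbedding'.isOpenMap _ hU
    have := hp.2 (Subtype.val '' U) hUo
      (hUc.image _ continuous_subtype_val.continuousOn) ⟨p, hpU, rfl⟩ G ?_ ?_ x ⟨x, hx, rfl⟩
    · rwa [hG] at this
    · rintro _ ⟨y, hy, rfl⟩
      refine (mdifferentiableAt_opens_iff.1 ?_).mdifferentiableWithinAt
      simp only [hG]
      exact (hf y hy).mdifferentiableAt (hU.mem_nhds hy)
    · rintro _ ⟨⟨y, hy, rfl⟩, hyS⟩
      rw [hG]
      exact h0 y ⟨hy, hyS⟩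

/-- The identity theorem in one variable. The copy `ULift ℂ` appears because test manifolds live in
the universe `w`. -/
lemma zero_mem_uniquenessPoints_ulift {S : Set (ULift.{w} ℂ)} {t : ℕ → ℂ}
    (ht : Filter.Tendsto t Filter.atTop (𝓝[≠] 0)) (htS : ∀ j, ULift.up (t j) ∈ S) :
    (0 : ULift.{w} ℂ) ∈ uniquenessPoints (ULift.{w} ℂ) S := by
  have ht' := tendsto_nhdsWithin_iff.1 ht
  have hup : Continuous (ULift.up : ℂ → ULift.{w} ℂ) := continuous_uliftUp
  refine ⟨mem_closure_of_tendsto ((hup.tendsto 0).comp ht'.1) (.of_forall htS),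
    fun U hU hUc h0U f hf hf0 x hx => ?_⟩
  let L : ℂ ≃L[ℂ] ULift.{w} ℂ := ContinuousLinearEquiv.ulift.symm
  have hL : ∀ z, L z = ULift.up z := fun _ => rfl
  have hd : DifferentiableOn ℂ (fun z => f (L z)) (L ⁻¹' U) := by
    rw [mdifferentiableOn_iff_differentiableOn] at hf
    exact hf.comp L.differentiableOn (Set.mapsTo_preimage _ _)
  have hLU : IsOpen (L ⁻¹' U) := hU.preimage L.continuous
  have hconn : IsPreconnected (L ⁻¹' U) :=
    (L.toHomeomorph.isPreconnected_preimage).2 hUc.isPreconnected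
  have hfreq : ∃ᶠ z in 𝓝[≠] (0 : ℂ), f (L z) = 0 := by
    refine ht.frequently (Filter.Eventually.frequently ?_)
    filter_upwards [ht'.1.eventually (hLU.mem_nhds (show (0 : ℂ) ∈ L ⁻¹' U by simpa using h0U))]
      with j hj
    exact hf0 _ ⟨hj, htS j⟩
  have := (hd.analyticOnNhd hLU).eqOn_zero_of_preconnected_of_frequently_eq_zero hconn
    (show (0 : ℂ) ∈ L ⁻¹' U by simpa using h0U) hfreq
  have h2 := this (show x.down ∈ L ⁻¹' U from hx)
  simpa [hL] using h2

end Uniqueness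

/-! ### The weak Vitali property implies hyperbolicity -/

section Hyperbolic

open Metric Filter

/-- The unit disk in the copy of `ℂ` living in the universe `w`. -/
def liftedUnitDisk : TopologicalSpace.Opens (ULift.{w} ℂ) := ⟨ball 0 1, isOpen_ball⟩

lemma mem_liftedUnitDisk {z : ULift.{w} ℂ} : z ∈ liftedUnitDisk.{w} ↔ ‖z.down‖ < 1 := by
  change z ∈ ball 0 1 ↔ _
  rw [mem_ball_zero_iff, ULift.norm_def]

instance : ConnectedSpace liftedUnitDisk.{w} :=
  Subtype.connectedSpace ⟨⟨0, by simp [liftedUnitDisk]⟩,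
    (convex_ball (0 : ULift.{w} ℂ) 1).isPreconnected⟩

/-- A polynomial vanishing at `0` and at `1/3, 1/4, …, 1/(k+2)`. -/
noncomputable def nodalPolynomial (k : ℕ) (z : ℂ) : ℂ :=
  z * ∏ j ∈ Finset.range k, (z - 1 / ((j : ℂ) + 3))

lemma norm_one_div_add_three_le (j : ℕ) : ‖(1 / ((j : ℂ) + 3))‖ ≤ 1 / 3 := by
  have : ((j : ℂ) + 3) = (((j : ℝ) + 3 : ℝ) : ℂ) := by push_cast; rfl
  rw [this, norm_div, norm_one, Complex.norm_real, Real.norm_eq_abs, abs_of_pos (by positivity)]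
  exact one_div_le_one_div_of_le (by norm_num) (by linarith [(Nat.cast_nonneg j : (0 : ℝ) ≤ j)])

lemma nodalPolynomial_half_ne_zero (k : ℕ) : nodalPolynomial k (1 / 2) ≠ 0 := by
  refine mul_ne_zero (by norm_num) (Finset.prod_ne_zero_iff.2 fun j _ h => ?_)
  have := norm_one_div_add_three_le j
  rw [← sub_eq_zero.1 h] at this
  norm_num at this

lemma norm_nodalPolynomial_le (k : ℕ) {z : ℂ} (hz : ‖z‖ < 1) : ‖nodalPolynomial k z‖ ≤ 2 ^ k := by
  rw [nodalPolynomial, norm_mul, norm_prod]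
  have h : ∏ j ∈ Finset.range k, ‖z - 1 / ((j : ℂ) + 3)‖ ≤ ∏ _j ∈ Finset.range k, (2 : ℝ) := by
    refine Finset.prod_le_prod (fun _ _ => norm_nonneg _) fun j _ => ?_
    linarith [norm_sub_le z (1 / ((j : ℂ) + 3)), norm_one_div_add_three_le j]
  rw [Finset.prod_const, Finset.card_range] at h
  calc _ ≤ 1 * (2 : ℝ) ^ k := by gcongr
    _ = _ := one_mul _

lemma nodalPolynomial_node {j k : ℕ} (h : j < k) : nodalPolynomial k (1 / ((j : ℂ) + 3)) = 0 :=
  mul_eq_zero_of_right _ (Finset.prod_eq_zero (Finset.mem_range.2 h) (sub_self _))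

lemma differentiable_nodalPolynomial (k : ℕ) : Differentiable ℂ (nodalPolynomial k) := by
  unfold nodalPolynomial; fun_prop

lemma tendsto_nodes : Tendsto (fun j : ℕ => (1 / ((j : ℂ) + 3))) atTop (𝓝[≠] 0) := by
  refine tendsto_nhdsWithin_iff.2 ⟨?_, .of_forall fun j => ?_⟩
  · have h := (tendsto_one_div_add_atTop_nhds_zero_nat (𝕜 := ℝ)).comp (tendsto_add_atTop_nat 2)
    have h2 := (Complex.continuous_ofReal.tendsto 0).comp h
    refine (Complex.ofReal_zero ▸ h2).congr fun j => ?_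
    simp only [Function.comp_apply]; push_cast; ring_nf
  · have : ((j : ℂ) + 3) ≠ 0 := by exact_mod_cast (by positivity : ((j : ℝ) + 3) ≠ 0)
    simp [this]

variable {E : Type u} {X : Type v} [NormedAddCommGroup E] [NormedSpace ℂ E]
  [TopologicalSpace X] [ChartedSpace E X]

lemma isCountablyGenerated_nhds_of_chartedSpace (E : Type*) {X : Type*} [NormedAddCommGroup E]
    [TopologicalSpace X] [ChartedSpace E X] (x : X) : (𝓝 x).IsCountablyGenerated := by
  rw [← (chartAt E x).symm_map_nhds_eq (mem_chart_source E x)]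
  infer_instance

/-- The precomposition of a map on the unit disk with `z ↦ c P_k(z) / P_k(1/2)`. -/
noncomputable def diskReparam.{a, b} {X : Type b} (f : ℂ → X) (c : ℂ) (k : ℕ) (z : liftedUnitDisk.{a}) : X :=
  f (c / nodalPolynomial k (1 / 2) * nodalPolynomial k z.1.down)

/-- As `|P_k| ≤ 2 ^ k` on the unit disk, the bound on `c` keeps the argument of `f` in the unit
disk. -/
lemma mdifferentiable_diskReparam {f : ℂ → X}
    (hf : MDifferentiableOn 𝓘(ℂ, ℂ) 𝓘(ℂ, E) f (ball 0 1)) {c : ℂ} {k : ℕ}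
    (hc : ‖c‖ < ‖nodalPolynomial k (1 / 2)‖ / 2 ^ k) :
    MDifferentiable 𝓘(ℂ, ULift.{w} ℂ) 𝓘(ℂ, E) (diskReparam.{w} f c k) := by
  intro z
  let h : ULift.{w} ℂ → ℂ := fun y => c / nodalPolynomial k (1 / 2) * nodalPolynomial k y.down
  have hd : Differentiable ℂ h := by
    have h1 : Differentiable ℂ (fun y : ULift.{w} ℂ => y.down) :=
      (ContinuousLinearEquiv.ulift (R₁ := ℂ) (M₁ := ℂ)).differentiable
    exact ((differentiable_nodalPolynomial k).comp h1).const_mul _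
  have hmem : h z.1 ∈ ball (0 : ℂ) 1 := by
    have hz : ‖z.1.down‖ < 1 := mem_liftedUnitDisk.1 z.2
    have hP : 0 < ‖nodalPolynomial k (1 / 2)‖ := norm_pos_iff.2 (nodalPolynomial_half_ne_zero k)
    rw [mem_ball_zero_iff, norm_mul, norm_div]
    calc _ ≤ ‖c‖ / ‖nodalPolynomial k (1 / 2)‖ * 2 ^ k := by
          gcongr; exact norm_nodalPolynomial_le k hz
      _ < 1 := by
          rw [div_mul_eq_mul_div, div_lt_one hP]
          rwa [lt_div_iff₀ (by positivity)] at hc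
  have h1 : MDifferentiableAt 𝓘(ℂ, ULift.{w} ℂ) 𝓘(ℂ, E) (f ∘ h) z.1 :=
    ((hf _ hmem).mdifferentiableAt (isOpen_ball.mem_nhds hmem)).comp z.1
      (hd z.1).mdifferentiableAt
  exact mdifferentiableAt_opens_iff.2 h1

/-- On a manifold with the weak Vitali property, holomorphic disks centred near `x` stay near `x`
on a disk of definite radius. -/
lemma HasWVP.exists_radius [IsManifold 𝓘(ℂ, E) ω X] (hX : HasWVP.{w} E X) (x : X)
    {B : Set X} (hB : B ∈ 𝓝 x) :
    ∃ r > 0, ∃ W ∈ 𝓝 x, ∀ f : ℂ → X, MDifferentiableOn 𝓘(ℂ, ℂ) 𝓘(ℂ, E) f (ball 0 1) →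
      f 0 ∈ W → ∀ z ∈ ball (0 : ℂ) r, f z ∈ B := by
  by_contra! hcon
  have := isCountablyGenerated_nhds_of_chartedSpace E x
  obtain ⟨W, hW⟩ := (𝓝 x).exists_antitone_basis
  choose f hf hf0 z hz hzB using fun k : ℕ =>
    hcon (‖nodalPolynomial k (1 / 2)‖ / 2 ^ k)
      (div_pos (norm_pos_iff.2 (nodalPolynomial_half_ne_zero k)) (by positivity)) (W k) (hW.mem k)
  simp only [mem_ball_zero_iff] at hz
  have hlim : Tendsto (fun k => f k 0) atTop (𝓝 x) := hW.tendsto hf0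
  have hmd := fun k => mdifferentiable_diskReparam.{u, v, w} (hf k) (hz k)
  have hlift : ∀ s : ℂ, ‖s‖ < 1 → (ULift.up s : ULift.{w} ℂ) ∈ liftedUnitDisk.{w} := fun s hs =>
    mem_liftedUnitDisk.2 hs
  -- The constant odd terms force the limit to be `x` everywhere; T1, which comes from the charts,
  -- is enough for this.
  let g : ℕ → Hol (ULift.{w} ℂ) E liftedUnitDisk.{w} X := fun k =>
    if Even k then ⟨⟨_, (hmd k).continuous⟩, hmd k⟩
    else ⟨ContinuousMap.const _ x, mdifferentiable_const⟩
  have hg : ∀ k a, (g k).1 a = if Even k then diskReparam.{w} (f k) (z k) k a else x := by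
    intro k a
    by_cases hk : Even k <;> simp [g, hk]
  have hconv : ∀ a : liftedUnitDisk.{w}, (∀ᶠ k in atTop, nodalPolynomial k a.1.down = 0) →
      a ∈ convergenceSet (fun k => ⇑(g k).1) Set.univ := by
    intro a ha
    refine ⟨x, trivial, ?_⟩
    refine Filter.tendsto_def.2 fun s hs => ?_
    filter_upwards [ha, hlim hs] with k hk hks
    simp only [Set.mem_preimage, hg]
    split_ifs
    · simpa [diskReparam, hk] using hks
    · exact mem_of_mem_nhds hs
  let a0 : liftedUnitDisk.{w} := ⟨0, hlift 0 (by simp)⟩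
  have h0 : a0 ∈ convergenceSet (fun k => ⇑(g k).1) Set.univ :=
    hconv _ (.of_forall fun k => by simp [a0, nodalPolynomial])
  have hu : a0 ∈ uniquenessPoints (ULift.{w} ℂ)
      (convergenceSet (fun k => ⇑(g k).1) Set.univ) := by
    refine uniquenessPoints_mono ?_ (mem_uniquenessPoints_opens
      (S := Set.range fun j : ℕ => (ULift.up (1 / ((j : ℂ) + 3)) : ULift.{w} ℂ))
      (zero_mem_uniquenessPoints_ulift tendsto_nodes fun j => ⟨j, rfl⟩))
    rintro a ⟨j, hj⟩
    refine hconv a ?_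
    filter_upwards [eventually_gt_atTop j] with k hk
    rw [← hj]
    exact nodalPolynomial_node hk
  obtain ⟨G, hG⟩ := hX _ _ g ⟨a0, h0, hu⟩
  have hpt : ∀ a, Tendsto (fun k => (g k).1 a) atTop (𝓝 (G.1 a)) := fun a =>
    ((continuous_eval_const (F := C(liftedUnitDisk.{w}, X)) a).tendsto _).comp
      ((continuous_subtype_val.tendsto G).comp hG)
  -- At `1/2` the even terms equal `f k (z k)`, which lies outside `B`.
  let b : liftedUnitDisk.{w} := ⟨ULift.up (1 / 2), hlift _ (by norm_num)⟩
  have hGb : G.1 b = x := by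
    have : T1Space X := ChartedSpace.t1Space E X
    by_contra hne
    obtain ⟨k, hk, hodd⟩ := ((hpt b).eventually
      (isOpen_compl_singleton.mem_nhds (show G.1 b ∈ ({x} : Set X)ᶜ from hne))).and_frequently
        Nat.frequently_odd |>.exists
    apply hk
    rw [hg, if_neg (Nat.not_even_iff_odd.2 hodd)]
    rfl
  have hev := (hpt b).eventually (hGb ▸ hB)
  obtain ⟨k, hk, heven⟩ := (hev.and_frequently Nat.frequently_even).exists
  rw [hg, if_pos heven] at hk
  apply hzB k
  have hb : diskReparam.{w} (f k) (z k) k b = f k (z k) := by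
    simp only [diskReparam, b, div_mul_cancel₀ _ (nodalPolynomial_half_ne_zero k)]
  rwa [hb] at hk

/-- A link of a short chain, recentred by a disk automorphism, stays in a chart ball on a disk of
fixed radius; the Schwarz lemma bounds the chart displacement by a multiple of its length. Summing
over links confines the whole chain. -/
theorem HasWVP.isHyperbolic [IsManifold 𝓘(ℂ, E) ω X] [ConnectedSpace X] (hX : HasWVP.{w} E X) :
    IsHyperbolic E X := by
  have htop : ∀ s : Set X, IsOpen s → ∀ x ∈ s,
      ∃ ε : ENNReal, 0 < ε ∧ ∀ y : X, kobayashiDist E x y < ε → y ∈ s := by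
    intro s hs x hxs
    set e := chartAt E x with he
    have hxe : x ∈ e.source := mem_chart_source E x
    have hmd : MDifferentiableOn 𝓘(ℂ, E) 𝓘(ℂ, E) e e.source :=
      mdifferentiableOn_atlas (chart_mem_atlas E x)
    let B : Set X := e.source ∩ e ⁻¹' ball (e x) 1
    have hBo : IsOpen B := e.isOpen_inter_preimage isOpen_ball
    obtain ⟨r, hr, W, hW, hrad⟩ := hX.exists_radius x (hBo.mem_nhds ⟨hxe, by simp⟩)
    obtain ⟨ρ, hρ, hρW⟩ : ∃ ρ > 0, ∀ y ∈ e.source, ‖e y - e x‖ < ρ → y ∈ W ∩ s := by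
      have h1 : ∀ᶠ v in 𝓝 (e x), e.symm v ∈ W ∩ s := by
        have := e.tendsto_symm hxe
        exact this (inter_mem hW (hs.mem_nhds hxs))
      obtain ⟨ρ, hρ, h⟩ := Metric.eventually_nhds_iff.1 h1
      refine ⟨ρ, hρ, fun y hy hyρ => ?_⟩
      have := h (y := e y) (by rwa [dist_eq_norm])
      rwa [e.left_inv hy] at this
    -- Two points of the unit chart ball `B` are within `2` of each other, and the recentred disk
    -- maps the disk of radius `min r 1` into `B`: this is the Schwarz constant.
    set C : ℝ := 2 / min r 1 with hC
    have hr1 : 0 < min r 1 := lt_min hr one_pos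
    have hC0 : 0 < C := by positivity
    have step : ∀ {f : ℂ → X} {a b : ℂ}, MDifferentiableOn 𝓘(ℂ, ℂ) 𝓘(ℂ, E) f (ball 0 1) →
        a ∈ ball (0 : ℂ) 1 → b ∈ ball (0 : ℂ) 1 → f a ∈ W → poincareDist a b < r →
        f b ∈ e.source ∧ ‖e (f b) - e (f a)‖ ≤ C * poincareDist a b := by
      intro f a b hf ha hb haW hab
      rw [mem_ball_zero_iff] at ha hb
      have hmaps : Set.MapsTo (diskInvolution a) (ball 0 1) (ball 0 1) := fun z hz =>
        mem_ball_zero_iff.2 (norm_diskInvolution_lt_one ha (mem_ball_zero_iff.1 hz))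
      have hg : MDifferentiableOn 𝓘(ℂ, ℂ) 𝓘(ℂ, E) (f ∘ diskInvolution a) (ball 0 1) :=
        hf.comp (mdifferentiableOn_iff_differentiableOn.2 (differentiableOn_diskInvolution ha))
          hmaps
      have hB := hrad _ hg (by simpa [diskInvolution_zero] using haW)
      have hle := norm_diskInvolution_le_poincareDist ha hb
      set c := diskInvolution a b with hc
      have hfc : (f ∘ diskInvolution a) c = f b := by
        simp [hc, diskInvolution_diskInvolution ha hb]
      have hf0 : (f ∘ diskInvolution a) 0 = f a := by simp [diskInvolution_zero]
      have hcr : c ∈ ball (0 : ℂ) r := mem_ball_zero_iff.2 (hle.trans_lt hab)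
      have hc1 : ‖c‖ < 1 := norm_diskInvolution_lt_one ha hb
      have hcr' : c ∈ ball (0 : ℂ) (min r 1) :=
        mem_ball_zero_iff.2 (lt_min (mem_ball_zero_iff.1 hcr) hc1)
      have hsub : ball (0 : ℂ) (min r 1) ⊆ ball 0 r := ball_subset_ball (min_le_left _ _)
      refine ⟨hfc ▸ (hB c hcr).1, ?_⟩
      have hd : DifferentiableOn ℂ (e ∘ (f ∘ diskInvolution a)) (ball 0 (min r 1)) := by
        rw [← mdifferentiableOn_iff_differentiableOn]
        exact hmd.comp (hg.mono (ball_subset_ball (min_le_right _ _)))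
          fun z hz => (hB z (hsub hz)).1
      have hm : Set.MapsTo (e ∘ (f ∘ diskInvolution a)) (ball 0 (min r 1))
          (closedBall ((e ∘ (f ∘ diskInvolution a)) 0) 2) := by
        intro z hz
        have h1 := mem_ball.1 (hB z (hsub hz)).2
        have h2 := mem_ball.1 (hB 0 (mem_ball_self hr)).2
        have := dist_triangle_right (e ((f ∘ diskInvolution a) z))
          (e ((f ∘ diskInvolution a) 0)) (e x)
        exact mem_closedBall.2 (by simp only [Function.comp_apply] at *; linarith)
      have := Complex.dist_le_div_mul_dist_of_mapsTo_ball hd hm hcr'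
      rw [Function.comp_apply (f := e), Function.comp_apply (f := e), hfc, hf0, dist_eq_norm,
        dist_zero_right] at this
      exact this.trans (mul_le_mul_of_nonneg_left hle hC0.le)
    -- The displacement so far plus `C` times the remaining length does not grow along the chain, so
    -- every vertex stays in `W` and `step` applies again.
    have chain : ∀ {p q : X} {l : ℝ}, HolChain E p q l → l < r → p ∈ e.source →
        ‖e p - e x‖ + C * l < ρ → q ∈ s := by
      intro p q l h
      induction h with
      | nil p =>
        intro _ hp hpρ
        exact (hρW p hp (by simpa using hpρ)).2
      | cons f a b q l hf ha hb h ih =>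
        intro hl hp hpρ
        have hl0 := h.length_nonneg
        have hd0 := poincareDist_nonneg (mem_ball_zero_iff.1 ha) (mem_ball_zero_iff.1 hb)
        have hW' : f a ∈ W := (hρW _ hp (by nlinarith)).1
        obtain ⟨h1, h2⟩ := step hf ha hb hW' (by linarith)
        refine ih (by linarith) h1 ?_
        have := norm_sub_le_norm_sub_add_norm_sub (e (f b)) (e (f a)) (e x)
        nlinarith
    refine ⟨ENNReal.ofReal (min r (ρ / C)), ENNReal.ofReal_pos.2 (by positivity), fun y hy => ?_⟩
    obtain ⟨l, hl, hlt⟩ := kobayashiDist_lt_iff.1 hy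
    have hlt' := (ENNReal.ofReal_lt_ofReal_iff (by positivity)).1 hlt
    refine chain hl (hlt'.trans_le (min_le_left _ _)) hxe ?_
    have := hlt'.trans_le (min_le_right _ _)
    rw [lt_div_iff₀ hC0] at this
    simpa [mul_comm] using this
  refine ⟨kobayashiDist_ne_top, fun p q hpq => ?_, fun s => ⟨htop s, isOpen_of_forall_kobayashiDist_lt⟩⟩
  have : T1Space X := ChartedSpace.t1Space E X
  by_contra hne
  obtain ⟨ε, hε, h⟩ := htop {q}ᶜ isOpen_compl_singleton p hne
  exact h q (hpq ▸ hε) rfl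

end Hyperbolic

/-! ### Regularization in `ℂᴺ` -/

section Regularization

open MeasureTheory Metric Real

/-- Taking a function of `∑ |y j|²` gives invariance under unit scalars and smoothness; the sup norm
is at most the Euclidean one, whence the support bound. -/
lemma exists_rotationInvariant_bump (N : ℕ) {ε : ℝ} (hε : 0 < ε) :
    ∃ χ : (Fin N → ℂ) → ℝ, ContDiff ℝ 1 χ ∧ HasCompactSupport χ ∧ (∀ y, 0 ≤ χ y) ∧
      (∀ y, χ y ≠ 0 → ‖y‖ ≤ ε) ∧ ∫ y, χ y = 1 ∧ ∀ c : ℂ, ‖c‖ = 1 → ∀ y, χ (c • y) = χ y := by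
  let ψ : (Fin N → ℂ) → ℝ := fun y =>
    smoothTransition (1 - (∑ j, ((y j).re ^ 2 + (y j).im ^ 2)) / ε ^ 2)
  have hsm : ContDiff ℝ 1 ψ := by
    have h : ∀ j, ContDiff ℝ 1 (fun y : Fin N → ℂ => (y j).re ^ 2 + (y j).im ^ 2) := fun j => by
      have h1 : ContDiff ℝ 1 (fun y : Fin N → ℂ => y j) := contDiff_apply ℝ ℂ j
      have h2 : ContDiff ℝ 1 (fun y : Fin N → ℂ => (y j).re) := Complex.reCLM.contDiff.comp h1
      have h3 : ContDiff ℝ 1 (fun y : Fin N → ℂ => (y j).im) := Complex.imCLM.contDiff.comp h1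
      exact (h2.pow 2).add (h3.pow 2)
    have h0 : ContDiff ℝ 1 smoothTransition := by
      simpa using smoothTransition.contDiff (n := 1)
    exact h0.comp
      (contDiff_const.sub ((ContDiff.sum fun j _ => h j).div_const _))
  have hsupp : ∀ y, ψ y ≠ 0 → ‖y‖ ≤ ε := by
    intro y hy
    by_contra! hlt
    apply hy
    refine smoothTransition.zero_of_nonpos ?_
    rw [sub_nonpos, one_le_div (by positivity)]
    obtain ⟨j, hj⟩ : ∃ j, ε < ‖y j‖ := by
      by_contra! hle
      exact hlt.not_ge ((pi_norm_le_iff_of_nonneg hε.le).2 hle)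
    calc ε ^ 2 ≤ ‖y j‖ ^ 2 := by gcongr
      _ = (y j).re ^ 2 + (y j).im ^ 2 := by
        rw [Complex.sq_norm, Complex.normSq_apply]; ring
      _ ≤ _ := Finset.single_le_sum (f := fun j => (y j).re ^ 2 + (y j).im ^ 2)
          (fun i _ => by positivity) (Finset.mem_univ j)
  have hc : HasCompactSupport ψ := by
    refine HasCompactSupport.of_support_subset_isCompact (isCompact_closedBall (0 : Fin N → ℂ) ε) ?_
    intro y hy
    simpa using hsupp y hy
  have hnn : ∀ y, 0 ≤ ψ y := fun y => smoothTransition.nonneg _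
  have hpos : 0 < ∫ y, ψ y :=
    hsm.continuous.integral_pos_of_hasCompactSupport_nonneg_nonzero hc hnn
      (x := 0) (by simp [ψ])
  have hrot : ∀ c : ℂ, ‖c‖ = 1 → ∀ y, ψ (c • y) = ψ y := by
    intro c hc y
    have : ∀ z : ℂ, z.re ^ 2 + z.im ^ 2 = ‖z‖ ^ 2 := fun z => by
      rw [Complex.sq_norm, Complex.normSq_apply]; ring
    simp only [ψ, this, Pi.smul_apply, smul_eq_mul, norm_mul, hc, one_mul]
  refine ⟨fun y => (∫ y, ψ y)⁻¹ * ψ y, contDiff_const.mul hsm, hc.mul_left,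
    fun y => mul_nonneg (inv_nonneg.2 hpos.le) (hnn y), fun y hy => hsupp y (right_ne_zero_of_mul hy), ?_,
    fun c hc y => by simp only [hrot c hc y]⟩
  rw [integral_const_mul, inv_mul_cancel₀ hpos.ne']

lemma circleAverage_integral_swap {α : Type*} [MeasurableSpace α] {μ : Measure α} [SFinite μ]
    {χ : α → ℝ} (hχ : Integrable χ μ) {k : ℂ → α → ℝ} (hk : Measurable (Function.uncurry k))
    {C : ℝ} (hC : ∀ z s, ‖k z s‖ ≤ C) (c : ℂ) (r : ℝ) :
    circleAverage (fun z => ∫ s, χ s * k z s ∂μ) c r =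
      ∫ s, χ s * circleAverage (fun z => k z s) c r ∂μ := by
  simp only [circleAverage_def, intervalIntegral.integral_of_le two_pi_pos.le, smul_eq_mul]
  have hm : Measurable (fun p : ℝ × α => k (circleMap c r p.1) p.2) :=
    hk.comp (((continuous_circleMap c r).measurable.comp measurable_fst).prodMk measurable_snd)
  rw [integral_integral_swap]
  · rw [← integral_const_mul]
    congr 1 with s
    rw [integral_const_mul]
    ring
  · exact (hχ.comp_snd (volume.restrict (Set.Ioc 0 (2 * π)))).mul_bdd (c := C)
      hm.aestronglyMeasurable (.of_forall fun p => hC _ _)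

lemma circleIntegrable_of_bounded {f : ℂ → ℝ} {c : ℂ} {r : ℝ}
    (hf : Measurable fun θ : ℝ => f (circleMap c r θ)) {C : ℝ}
    (hC : ∀ θ : ℝ, ‖f (circleMap c r θ)‖ ≤ C) : CircleIntegrable f c r := by
  rw [CircleIntegrable, intervalIntegrable_iff]
  exact Measure.integrableOn_of_bounded (by rw [Set.uIoc]; exact measure_Ioc_lt_top.ne) hf.aestronglyMeasurable
    (M := C) (.of_forall hC)

lemma measurePreserving_unit_smul {N : ℕ} {c : ℂ} (hc : ‖c‖ = 1) :
    MeasurePreserving (fun y : Fin N → ℂ => c • y) := by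
  let a : Circle := ⟨c, by simpa [Submonoid.unitSphere] using hc⟩
  exact volume_preserving_pi (fun _ : Fin N => (rotation a).measurePreserving)

lemma integral_unit_smul {N : ℕ} {c : ℂ} (hc : ‖c‖ = 1) (f : (Fin N → ℂ) → ℝ) :
    ∫ y, f (c • y) = ∫ y, f y := by
  have hc0 : c ≠ 0 := norm_pos_iff.1 (hc ▸ one_pos)
  exact (measurePreserving_unit_smul hc).integral_comp
    (Homeomorph.smulOfNeZero c hc0).measurableEmbedding f

/-- Regularization of bounded functions having the sub-mean value property on complex lines. -/
lemma exists_regularization {N : ℕ} {G : Set (Fin N → ℂ)} {w : (Fin N → ℂ) → ℝ}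
    (hw : Measurable w) {C : ℝ} (hC : ∀ y, ‖w y‖ ≤ C)
    (hsub : ∀ x y, (∀ ζ : ℂ, ‖ζ‖ ≤ 1 → x + ζ • y ∈ G) →
      w x ≤ circleAverage (fun ζ => w (x + ζ • y)) 0 1) {ε : ℝ} (hε : 0 < ε) :
    ∃ g : (Fin N → ℂ) → ℝ, ContDiff ℝ 1 g ∧
      (∀ x, closedBall x ε ⊆ G → w x ≤ g x) ∧
      (∀ x y, (∀ ζ : ℂ, ‖ζ‖ ≤ 1 → closedBall (x + ζ • y) ε ⊆ G) →
        g x ≤ circleAverage (fun ζ => g (x + ζ • y)) 0 1) ∧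
      ∀ x t, (∀ z ∈ closedBall x ε, w z ≤ t) → g x ≤ t := by
  obtain ⟨χ, hχd, hχc, hχ0, hχs, hχ1, hχr⟩ := exists_rotationInvariant_bump N hε
  have hχi : Integrable χ := hχd.continuous.integrable_of_hasCompactSupport hχc
  have hint : ∀ k : (Fin N → ℂ) → ℝ, Measurable k → (∀ s, ‖k s‖ ≤ C) →
      Integrable fun s => χ s * k s := fun k hk hkC =>
    hχi.mul_bdd (c := C) hk.aestronglyMeasurable (.of_forall hkC)
  have hmono : ∀ (a b : (Fin N → ℂ) → ℝ), Integrable (fun s => χ s * a s) →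
      Integrable (fun s => χ s * b s) → (∀ s, ‖s‖ ≤ ε → a s ≤ b s) →
      ∫ s, χ s * a s ≤ ∫ s, χ s * b s := by
    intro a b ha hb hab
    refine integral_mono ha hb fun s => ?_
    by_cases h : χ s = 0
    · simp [h]
    · exact mul_le_mul_of_nonneg_left (hab s (hχs s h)) (hχ0 s)
  have hconst : ∀ t : ℝ, ∫ s, χ s * t = t := fun t => by rw [integral_mul_const, hχ1, one_mul]
  have hshift : ∀ x, Measurable fun s => w (x - s) := fun x => hw.comp (by fun_prop)
  have hav : ∀ (k : ℂ → (Fin N → ℂ) → ℝ), Measurable (Function.uncurry k) →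
      (∀ z s, ‖k z s‖ ≤ C) →
      Integrable (fun s => χ s * circleAverage (fun z => k z s) 0 1) := by
    intro k hk hkC
    have hm : StronglyMeasurable (fun s => circleAverage (fun z => k z s) 0 1) := by
      simp only [circleAverage_def, intervalIntegral.integral_of_le two_pi_pos.le, smul_eq_mul]
      refine StronglyMeasurable.const_mul ?_ _
      have : Measurable (fun p : (Fin N → ℂ) × ℝ => k (circleMap 0 1 p.2) p.1) :=
        hk.comp (((continuous_circleMap 0 1).measurable.comp measurable_snd).prodMk measurable_fst)
      exact this.stronglyMeasurable.integral_prod_right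
    refine hχi.mul_bdd (c := C) hm.aestronglyMeasurable (.of_forall fun s => ?_)
    have hci : CircleIntegrable (fun z => k z s) 0 1 :=
      circleIntegrable_of_bounded (C := C) (hk.comp
        ((continuous_circleMap 0 1).measurable.prodMk measurable_const)) fun θ => hkC _ _
    rw [norm_eq_abs, abs_le]
    constructor
    · rw [← circleAverage_const (-C) 0 1]
      exact circleAverage_mono (circleIntegrable_const _ _ _) hci fun z _ => (abs_le.1 (hkC z s)).1
    · rw [← circleAverage_const C 0 1]
      exact circleAverage_mono hci (circleIntegrable_const _ _ _) fun z _ => (abs_le.1 (hkC z s)).2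
  refine ⟨fun x => ∫ s, χ s * w (x - s), ?_, ?_, ?_, ?_⟩
  · have hloc : LocallyIntegrable w :=
      (memLp_top_of_bound hw.aestronglyMeasurable C (.of_forall hC)).locallyIntegrable le_top
    have := hχc.contDiff_convolution_left (n := 1) (μ := volume) (ContinuousLinearMap.mul ℝ ℝ)
      (by exact_mod_cast hχd) hloc
    exact this
  · intro x hx
    -- Rotation invariance of `χ` lets `s` be replaced by `z • s` for `|z| = 1`; averaging over `z`
    -- reduces `w x ≤ g x` to the sub-mean inequality on the lines through `x`.
    let k : ℂ → (Fin N → ℂ) → ℝ := fun z s => w (x - z • s)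
    have hk : Measurable (Function.uncurry k) := hw.comp (by fun_prop)
    have h1 : ∀ z ∈ sphere (0 : ℂ) |1|, ∫ s, χ s * k z s = ∫ s, χ s * w (x - s) := by
      intro z hz
      have hz1 : ‖z‖ = 1 := by simpa using hz
      rw [← integral_unit_smul hz1 (fun s => χ s * w (x - s))]
      simp only [k, hχr z hz1]
    have h2 := circleAverage_integral_swap hχi hk (fun z s => hC _) 0 1
    rw [circleAverage_const_on_circle h1] at h2
    simp only [h2]
    calc w x = ∫ s, χ s * w x := (hconst _).symm
      _ ≤ _ := hmono _ _ (hχi.mul_const _) (hav k hk fun z s => hC _) fun s hs => by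
        have := hsub x (-s) fun ζ hζ => hx (by
          simp only [smul_neg, mem_closedBall, dist_self_add_left, norm_neg, norm_smul]
          nlinarith [norm_nonneg s])
        simpa [k, sub_eq_add_neg] using this
  · intro x y hxy
    let k : ℂ → (Fin N → ℂ) → ℝ := fun z s => w (x + z • y - s)
    have hk : Measurable (Function.uncurry k) := hw.comp (by fun_prop)
    have h2 := circleAverage_integral_swap hχi hk (fun z s => hC _) 0 1
    simp only [k] at h2
    rw [h2]
    refine hmono _ _ (hint _ (hshift x) fun _ => hC _) (hav k hk fun z s => hC _) fun s hs => ?_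
    have := hsub (x - s) y fun ζ hζ => hxy ζ hζ (by
      rw [mem_closedBall, dist_eq_norm]
      rwa [show x - s + ζ • y - (x + ζ • y) = -s by abel, norm_neg])
    refine this.trans_eq ?_
    simp only [sub_add_eq_add_sub]
  · intro x t ht
    calc _ ≤ ∫ s, χ s * t :=
          hmono _ _ (hint _ (hshift x) fun _ => hC _) (hχi.mul_const _) fun s hs =>
            ht _ (by simpa [dist_eq_norm] using hs)
      _ = t := hconst t

end Regularization

/-! ### Plurisubharmonic functions along holomorphic curves -/

section Curves

open MeasureTheory Metric Real Filter Asymptotics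

/-- A function which is strictly differentiable and has the sub-mean value property on small disks
in the direction of a holomorphic curve cannot be touched from above along this curve by a strictly
superharmonic quadratic polynomial. -/
lemma not_touch_of_contDiff {Y : Type*} [NormedAddCommGroup Y] [NormedSpace ℂ Y] [CompleteSpace Y]
    {g : Y → ℝ} (hg : ContDiff ℝ 1 g) {η : ℂ → Y} {c : ℂ} (hη : Differentiable ℂ η)
    (hsub : ∀ᶠ r : ℝ in 𝓝[>] 0,
      g (η c) ≤ circleAverage (fun ζ => g (η c + ζ • (r : ℂ) • deriv η c)) 0 1)
    {α β : ℂ} {κ : ℝ} (hκ : 0 < κ)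
    (htouch : ∀ᶠ s in 𝓝 c, g (η s) ≤
      g (η c) + (α * (s - c) + β * (s - c) ^ 2).re - κ * ‖s - c‖ ^ 2) : False := by
  set a := deriv η c
  -- `R` is the holomorphic deviation of the curve from its tangent line, of second order at `c`.
  -- Being holomorphic with `R c = 0`, it has mean zero on circles about `c`, and so has `L ∘ R`.
  set R : ℂ → Y := fun s => η s - (η c + (s - c) • a) with hR
  have hRd : Differentiable ℂ R := by simp only [hR]; fun_prop
  obtain ⟨K, hK0, hK⟩ : ∃ K > 0, ∀ᶠ s in 𝓝 c, ‖R s‖ ≤ K * ‖s - c‖ ^ 2 := by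
    obtain ⟨p, hp⟩ := hη.analyticAt c
    have h1 := hp.isBigO_sub_partialSum_pow 2
    obtain ⟨K, hK0, hK⟩ := h1.exists_pos
    refine ⟨K, hK0, ?_⟩
    have h2 : Tendsto (fun s : ℂ => s - c) (𝓝 c) (𝓝 0) := by
      have : ContinuousAt (fun s : ℂ => s - c) c := by fun_prop
      simpa [ContinuousAt] using this
    filter_upwards [h2.eventually hK.bound] with s hs
    have hco : p.coeff 1 = a := hp.deriv.symm
    have hc0 : p.coeff 0 = η c := hp.coeff_zero _
    simp only [FormalMultilinearSeries.partialSum, Finset.sum_range_succ, Finset.range_zero,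
      Finset.sum_empty, zero_add, FormalMultilinearSeries.apply_eq_pow_smul_coeff, pow_zero,
      one_smul, pow_one, hco, hc0, add_sub_cancel] at hs
    simpa [hR] using hs
  obtain ⟨τ, hτ, hτK⟩ : ∃ τ > 0, τ * K < κ := ⟨κ / (2 * K), by positivity, by field_simp; norm_num⟩
  set L := fderiv ℝ g (η c)
  have hstrict : HasStrictFDerivAt g L (η c) := hg.contDiffAt.hasStrictFDerivAt (by norm_num)
  have hlin : ∀ᶠ s in 𝓝 c, ‖g (η s) - g (η c + (s - c) • a) - L (R s)‖ ≤ τ * ‖R s‖ := by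
    have h1 := (hstrict.isLittleO.def hτ)
    have h2 : Tendsto (fun s => (η s, η c + (s - c) • a)) (𝓝 c) (𝓝 (η c, η c)) := by
      have : ContinuousAt (fun s => (η s, η c + (s - c) • a)) c :=
        (hη.continuous.prodMk (by fun_prop)).continuousAt
      simpa [ContinuousAt] using this
    exact h2.eventually h1
  -- The touching inequality moves from the curve to the tangent line at the cost of `L (R s)`,
  -- which disappears in the mean, and of `τ * K * r ^ 2`, which is less than the strict gain `κ * r
  -- ^ 2`.
  obtain ⟨r, hr0, hmean, hball⟩ : ∃ r : ℝ, 0 < r ∧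
      g (η c) ≤ circleAverage (fun ζ => g (η c + ζ • (r : ℂ) • a)) 0 1 ∧
      ∀ s, ‖s - c‖ = r → g (η c + (s - c) • a) ≤
        (g (η c) - (κ - τ * K) * r ^ 2) +
          ((α * (s - c) + β * (s - c) ^ 2).re - L (R s)) := by
    obtain ⟨r0, hr0, h⟩ := Metric.eventually_nhds_iff.1 ((hK.and hlin).and htouch)
    obtain ⟨r, h1, h2⟩ := (hsub.and (Ioo_mem_nhdsGT hr0)).exists
    refine ⟨r, h2.1, h1, fun s hs => ?_⟩
    obtain ⟨⟨h3, h4⟩, h5⟩ := h (y := s) (by rw [dist_eq_norm, hs]; exact h2.2)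
    rw [hs] at h3 h5
    have h6 := (abs_le.1 h4).1
    have h7 := mul_le_mul_of_nonneg_left h3 hτ.le
    nlinarith
  have hmean' : g (η c) ≤ circleAverage (fun s => g (η c + (s - c) • a)) c r := by
    rw [circleAverage_eq_circleAverage_zero_one]
    refine hmean.trans_eq ?_
    congr 1 with ζ
    rw [add_sub_cancel_right, smul_smul, mul_comm]
  have hgc := hg.continuous
  have hφ1 : Continuous fun s => g (η c + (s - c) • a) := by fun_prop
  let Q : ℂ → ℂ := fun s => α * (s - c) + β * (s - c) ^ 2
  have hQd : Differentiable ℂ Q := by fun_prop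
  have hRc : R c = 0 := by simp [hR]
  have hQc : Q c = 0 := by simp [Q]
  have hav1 : circleAverage (fun s => (Q s).re) c r = 0 := by
    have := Complex.reCLM.circleAverage_comp_comm (hQd.continuous.continuousOn.circleIntegrable hr0.le (c := c))
    rw [hQd.diffContOnCl.circleAverage, hQc] at this
    simpa [Function.comp_def] using this
  have hav2 : circleAverage (fun s => L (R s)) c r = 0 := by
    have := L.circleAverage_comp_comm (hRd.continuous.continuousOn.circleIntegrable hr0.le (c := c))
    rw [hRd.diffContOnCl.circleAverage, hRc] at this
    simpa [Function.comp_def] using this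
  have hi1 : CircleIntegrable (fun s => (Q s).re) c r :=
    (Complex.continuous_re.comp hQd.continuous).continuousOn.circleIntegrable hr0.le
  have hi2 : CircleIntegrable (fun s => L (R s)) c r :=
    (L.continuous.comp hRd.continuous).continuousOn.circleIntegrable hr0.le
  have hle := circleAverage_mono (hφ1.continuousOn.circleIntegrable hr0.le)
    ((circleIntegrable_const (g (η c) - (κ - τ * K) * r ^ 2) c r).add (hi1.sub hi2))
    (fun s hs => hball s (by simpa [abs_of_pos hr0, dist_eq_norm] using hs))
  rw [circleAverage_add (circleIntegrable_const _ _ _) (hi1.sub hi2),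
    circleAverage_sub hi1 hi2, hav1, hav2, circleAverage_const] at hle
  have : 0 < (κ - τ * K) * r ^ 2 := mul_pos (by linarith) (by positivity)
  linarith

variable {E : Type*} [NormedAddCommGroup E] [NormedSpace ℂ E]

lemma IsPshOn.mono {u : E → EReal} {B B' : Set E} (hu : IsPshOn u B) (h : B' ⊆ B) :
    IsPshOn u B' :=
  ⟨fun x hx => hu.1 x (h hx), hu.2.1.mono h, fun x v =>
    ⟨fun _ hζ => hu.1 _ (h hζ), (hu.2.2 x v).2.1.mono fun _ => (h ·),
      fun c r hr hcr => (hu.2.2 x v).2.2 c r hr (hcr.trans fun _ hζ => h hζ)⟩⟩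

open Classical in
/-- The truncation from below at `-M` of the restriction of `u` to a finite dimensional affine
subspace. -/
noncomputable def truncatedPullback {N : ℕ} (u : E → EReal) (B : Set E) (x₀ : E)
    (T : (Fin N → ℂ) →L[ℂ] E) (M : ℕ) (y : Fin N → ℂ) : ℝ :=
  if x₀ + T y ∈ B then (max (u (x₀ + T y)) ((-(M : ℝ) : ℝ) : EReal)).toReal else -M

/-! ### Truncated restrictions to finite-dimensional affine subspaces. -/

section Truncated

variable {N : ℕ} {u : E → EReal} {B : Set E} {x₀ : E} {T : (Fin N → ℂ) →L[ℂ] E} {M : ℕ}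

lemma coe_toReal_max {x : EReal} (hx : x < ⊤) (m : ℝ) :
    ((max x (m : EReal)).toReal : EReal) = max x m := by
  refine EReal.coe_toReal (max_lt hx (EReal.coe_lt_top m)).ne ?_
  exact ((EReal.bot_lt_coe m).trans_le (le_max_right _ _)).ne'

lemma coe_truncatedPullback (hu : ∀ x ∈ B, u x < ⊤) {y : Fin N → ℂ} (hy : x₀ + T y ∈ B) :
    (truncatedPullback u B x₀ T M y : EReal) = max (u (x₀ + T y)) ((-(M : ℝ) : ℝ) : EReal) := by
  rw [truncatedPullback, if_pos hy, coe_toReal_max (hu _ hy)]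

lemma neg_le_truncatedPullback (hu : ∀ x ∈ B, u x < ⊤) (y : Fin N → ℂ) :
    -(M : ℝ) ≤ truncatedPullback u B x₀ T M y := by
  by_cases hy : x₀ + T y ∈ B
  · rw [← EReal.coe_le_coe_iff, coe_truncatedPullback hu hy]
    exact le_max_right _ _
  · rw [truncatedPullback, if_neg hy]

lemma truncatedPullback_le (hu : ∀ x ∈ B, u x < ⊤) {y : Fin N → ℂ} {t : ℝ} (ht : -(M : ℝ) ≤ t)
    (h : x₀ + T y ∈ B → u (x₀ + T y) ≤ t) : truncatedPullback u B x₀ T M y ≤ t := by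
  by_cases hy : x₀ + T y ∈ B
  · rw [← EReal.coe_le_coe_iff, coe_truncatedPullback hu hy]
    exact max_le (h hy) (EReal.coe_le_coe_iff.2 ht)
  · rw [truncatedPullback, if_neg hy]
    exact ht

/-- Above the level `-M`, a strict sublevel set is an open set together with the closed set where
the default value `-M` is taken. -/
lemma measurable_truncatedPullback (hB : IsOpen B) (hu : IsPshOn u B) :
    Measurable (truncatedPullback u B x₀ T M) := by
  refine measurable_of_Iio fun t => ?_
  by_cases ht : t ≤ -(M : ℝ)
  · convert MeasurableSet.empty
    ext y
    simpa using ht.trans (neg_le_truncatedPullback hu.1 y)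
  · push Not at ht
    let G : Set (Fin N → ℂ) := {y | x₀ + T y ∈ B}
    have hG : IsOpen G := hB.preimage (f := fun y => x₀ + T y) (by fun_prop)
    have hO : IsOpen {y | x₀ + T y ∈ B ∧ u (x₀ + T y) < t} := by
      rw [isOpen_iff_mem_nhds]
      rintro y ⟨hy, hyt⟩
      have h1 : ∀ᶠ x in 𝓝 (x₀ + T y), u x < t := by
        have := hu.2.1 _ hy t hyt
        rwa [hB.nhdsWithin_eq hy] at this
      have h2 : ContinuousAt (fun y => x₀ + T y) y := by fun_prop
      exact (h2.eventually (hB.mem_nhds hy)).and (h2.eventually h1)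
    convert hG.measurableSet.compl.union hO.measurableSet
    ext y
    by_cases hy : x₀ + T y ∈ B
    · have h1 := coe_truncatedPullback (M := M) hu.1 hy
      simp only [Set.mem_preimage, Set.mem_Iio, Set.mem_union, Set.mem_compl_iff, G,
        Set.mem_ofPred_eq, hy, not_true_eq_false, true_and, false_or]
      rw [← EReal.coe_lt_coe_iff, h1, max_lt_iff]
      exact and_iff_left (EReal.coe_lt_coe_iff.2 ht)
    · simp [truncatedPullback, G, hy, ht]

/-- `circleMean` is an infimum over truncation levels; its term at level `M` is the average of the
truncation, which also dominates the constant `-M`. -/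
lemma truncatedPullback_le_circleAverage (hB : IsOpen B) (hu : IsPshOn u B) {C : ℝ}
    (hC : ∀ y, ‖truncatedPullback u B x₀ T M y‖ ≤ C) (x y : Fin N → ℂ)
    (hxy : ∀ ζ : ℂ, ‖ζ‖ ≤ 1 → x₀ + T (x + ζ • y) ∈ B) :
    truncatedPullback u B x₀ T M x ≤
      circleAverage (fun ζ => truncatedPullback u B x₀ T M (x + ζ • y)) 0 1 := by
  have hx : x₀ + T x ∈ B := by simpa using hxy 0 (by simp)
  have hT : ∀ ζ : ℂ, x₀ + T (x + ζ • y) = x₀ + T x + ζ • T y := fun ζ => by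
    rw [map_add, map_smul, add_assoc]
  have hci : CircleIntegrable (fun ζ => truncatedPullback u B x₀ T M (x + ζ • y)) 0 1 :=
    circleIntegrable_of_bounded (C := C)
      ((measurable_truncatedPullback hB hu).comp (by fun_prop)) fun θ => hC _
  refine truncatedPullback_le hu.1 ?_ fun _ => ?_
  · rw [← circleAverage_const (-(M : ℝ)) 0 1]
    exact circleAverage_mono (circleIntegrable_const _ _ _) hci
      fun z _ => neg_le_truncatedPullback hu.1 _
  · have h1 := (hu.2.2 (x₀ + T x) (T y)).2.2 0 1 one_pos fun ζ hζ => by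
      have := hxy ζ (by simpa using hζ)
      rwa [hT] at this
    simp only [zero_smul, add_zero] at h1
    refine (h1.trans (iInf_le _ M)).trans_eq ?_
    congr 1
    refine circleAverage_congr_sphere fun ζ hζ => ?_
    have := hxy ζ (by simpa using (mem_sphere.1 hζ).le)
    simp only [truncatedPullback, if_pos this, hT]

end Truncated

end Curves

/-! ### Plurisubharmonic functions on arbitrary holomorphic curves. -/

section NotTouch

open MeasureTheory Metric Real Filter Asymptotics

variable {E : Type*} [NormedAddCommGroup E] [NormedSpace ℂ E]

/-- A holomorphic curve is uniformly approximated, near a point, by polynomial curves with the same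
value at this point. -/
lemma exists_polynomial_approx [CompleteSpace E] {H : ℂ → E} (hH : ∀ᶠ s in 𝓝 0, DifferentiableAt ℂ H s) :
    ∃ R > 0, ∀ r < R, ∀ δ > 0, ∃ (N : ℕ) (T : (Fin N → ℂ) →L[ℂ] E), ∀ s : ℂ, ‖s‖ ≤ r →
      ‖H 0 + T (fun j => s ^ (j.1 + 1)) - H s‖ < δ := by
  obtain ⟨R, hR, hball⟩ := Metric.eventually_nhds_iff.1 hH
  set R' : NNReal := ⟨R / 2, by positivity⟩ with hR'
  have hR'0 : 0 < R' := by rw [← NNReal.coe_pos]; exact half_pos hR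
  have hd : DifferentiableOn ℂ H (closedBall 0 R') := fun s hs =>
    (hball (show dist s 0 < R by
      have : dist s 0 ≤ R / 2 := hs
      linarith)).differentiableWithinAt
  have hp := hd.hasFPowerSeriesOnBall hR'0
  set p := cauchyPowerSeries H 0 R'
  refine ⟨R', hR'0, fun r hr δ hδ => ?_⟩
  obtain ⟨r', hrr', hr'⟩ := exists_between (max_lt hr (NNReal.coe_pos.2 hR'0))
  have hr'0 : 0 ≤ r' := (le_max_right _ _).trans hrr'.le
  have hu := hp.tendstoUniformlyOn (r' := ⟨r', hr'0⟩) (by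
    exact ENNReal.coe_lt_coe.2 (NNReal.coe_lt_coe.1 hr'))
  have hev := (Metric.tendstoUniformlyOn_iff.1 hu δ hδ)
  obtain ⟨n, hn, hn1⟩ := (hev.and (eventually_ge_atTop 1)).exists
  obtain ⟨N, rfl⟩ : ∃ N, n = N + 1 := ⟨n - 1, by omega⟩
  -- The Taylor coefficients of positive order define `T`. The exponents start at `1`, so the
  -- polynomial curve passes exactly through `H 0`.
  refine ⟨N, ∑ j : Fin N, (ContinuousLinearMap.proj j).smulRight (p.coeff (j.1 + 1)),
    fun s hs => ?_⟩
  have := hn s (by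
    rw [mem_ball_zero_iff]
    exact hs.trans_lt ((le_max_left _ _).trans_lt hrr'))
  rw [dist_comm, dist_eq_norm, zero_add] at this
  have hS : H 0 + (∑ j : Fin N, (ContinuousLinearMap.proj (R := ℂ) (φ := fun _ : Fin N => ℂ)
      j).smulRight (p.coeff (j.1 + 1))) (fun j => s ^ (j.1 + 1)) = p.partialSum (N + 1) s := by
    change _ = ∑ k ∈ Finset.range (N + 1), p k fun _ => s
    rw [Finset.sum_range_succ', add_comm]
    simp only [FormalMultilinearSeries.apply_eq_pow_smul_coeff]
    congr 1
    · rw [Finset.sum_range]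
      simp
    · have : p.coeff 0 = H 0 := hp.coeff_zero _
      simp [this]
  rw [hS]
  exact this

lemma IsPshOn.isOpen_setOf_lt {u : E → EReal} {B : Set E} (hB : IsOpen B) (hu : IsPshOn u B)
    {Z : Type*} [TopologicalSpace Z] {P : Z → ℝ} (hP : Continuous P) :
    IsOpen {q : Z × E | q.2 ∈ B ∧ u q.2 < (P q.1 : EReal)} := by
  rw [isOpen_iff_mem_nhds]
  rintro ⟨z, x⟩ ⟨hx, hlt⟩
  obtain ⟨t, ht1, ht2⟩ := EReal.lt_iff_exists_real_btwn.1 hlt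
  have h1 : ∀ᶠ x' in 𝓝 x, u x' < t := by
    have := hu.2.1 x hx t ht1
    rwa [hB.nhdsWithin_eq hx] at this
  have h2 : ∀ᶠ z' in 𝓝 z, t < P z' :=
    hP.continuousAt.eventually (lt_mem_nhds (EReal.coe_lt_coe_iff.1 ht2))
  rw [nhds_prod_eq]
  filter_upwards [(h2.prod_mk h1), (Filter.tendsto_snd.eventually (hB.mem_nhds hx))]
    with q hq hqB
  exact ⟨hqB, hq.2.trans (EReal.coe_lt_coe_iff.2 hq.1)⟩

/-- A plurisubharmonic function restricted to a holomorphic curve is not touched from above by a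
strictly superharmonic quadratic polynomial. -/
lemma IsPshOn.not_touch [CompleteSpace E] {u : E → EReal} {B : Set E} (hB : IsOpen B)
    (hu : IsPshOn u B) {H : ℂ → E} (hH : ∀ᶠ s in 𝓝 0, DifferentiableAt ℂ H s) (hH0 : H 0 ∈ B)
    {v₀ : ℝ} (hv : u (H 0) = v₀) {α β : ℂ} {κ : ℝ} (hκ : 0 < κ)
    (htouch : ∀ᶠ s in 𝓝 0, u (H s) ≤
      ((v₀ + (α * s + β * s ^ 2).re - κ * ‖s‖ ^ 2 : ℝ) : EReal)) : False := by
  have hHc : ContinuousAt H 0 := hH.self_of_nhds.continuousAt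
  -- shrink the domain so that `u` is bounded above
  obtain ⟨ρ, hρ, hρB⟩ : ∃ ρ > 0, ∀ x ∈ ball (H 0) (2 * ρ), x ∈ B ∧ u x < ((v₀ + 1 : ℝ) : EReal) := by
    have h1 : ∀ᶠ x in 𝓝 (H 0), u x < ((v₀ + 1 : ℝ) : EReal) := by
      have := hu.2.1 _ hH0 ((v₀ + 1 : ℝ) : EReal) (by
        exact hv.trans_lt (EReal.coe_lt_coe_iff.2 (lt_add_one _)))
      rwa [hB.nhdsWithin_eq hH0] at this
    obtain ⟨ρ, hρ, h⟩ := Metric.eventually_nhds_iff.1 ((hB.eventually_mem hH0).and h1)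
    exact ⟨ρ / 2, half_pos hρ, fun x hx => h (by rw [mem_ball] at hx; linarith)⟩
  set B₁ := ball (H 0) (2 * ρ) with hB₁
  have hu₁ : IsPshOn u B₁ := hu.mono fun x hx => (hρB x hx).1
  obtain ⟨R, hR, happ⟩ := exists_polynomial_approx hH
  obtain ⟨r, hr0, hrR, hr⟩ : ∃ r : ℝ, 0 < r ∧ r < R ∧ ∀ s : ℂ, ‖s‖ ≤ r → H s ∈ ball (H 0) ρ ∧
      u (H s) ≤ ((v₀ + (α * s + β * s ^ 2).re - κ * ‖s‖ ^ 2 : ℝ) : EReal) ∧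
      DifferentiableAt ℂ H s := by
    obtain ⟨r, hr0, h⟩ := Metric.eventually_nhds_iff.1
      ((hHc.eventually (ball_mem_nhds _ hρ)).and (htouch.and hH))
    refine ⟨min r R / 2, by positivity, ?_, fun s hs => h ?_⟩
    · linarith [min_le_right r R, lt_min hr0 hR]
    · rw [dist_zero_right]; linarith [min_le_left r R, lt_min hr0 hR]
  -- Giving up half of `κ` opens a gap: on `‖s‖ = r`, `u ∘ H` is at most `P - κ / 2 * r ^ 2 < P -
  -- m`, which survives the approximation and the smoothing.
  let P : ℂ → ℝ := fun s => v₀ + (α * s + β * s ^ 2).re - κ / 2 * ‖s‖ ^ 2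
  have hPc : Continuous P := by
    have : Continuous fun s : ℂ => (α * s + β * s ^ 2).re :=
      Complex.continuous_re.comp (by fun_prop)
    fun_prop
  set m := κ / 4 * r ^ 2 with hm
  have hm0 : 0 < m := by positivity
  have hHcont : ContinuousOn H (closedBall 0 r) := fun s hs =>
    ((hr s (by simpa using hs)).2.2).continuousAt.continuousWithinAt
  obtain ⟨δ, hδ, hδu⟩ : ∃ δ > 0, ∀ s : ℂ, ‖s‖ = r → ∀ x, dist x (H s) < δ →
      u x < ((P s - m : ℝ) : EReal) := by
    have hKc : IsCompact ((fun s => (s, H s)) '' sphere (0 : ℂ) r) :=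
      (isCompact_sphere _ _).image_of_continuousOn
        (continuousOn_id.prodMk (hHcont.mono sphere_subset_closedBall))
    obtain ⟨δ, hδ, hsub⟩ := hKc.exists_thickening_subset_open
      (hu₁.isOpen_setOf_lt isOpen_ball (hPc.sub continuous_const) (P := fun s => P s - m)) (by
        rintro _ ⟨s, hs, rfl⟩
        have hs' : ‖s‖ = r := by simpa using hs
        obtain ⟨h1, h2, -⟩ := hr s hs'.le
        refine ⟨ball_subset_ball (by linarith) h1, h2.trans_lt (EReal.coe_lt_coe_iff.2 ?_)⟩
        simp only [P, hs']
        nlinarith [pow_pos hr0 2])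
    refine ⟨δ, hδ, fun s hs x hx => ?_⟩
    have : (s, x) ∈ thickening δ ((fun s => (s, H s)) '' sphere (0 : ℂ) r) := by
      rw [mem_thickening_iff]
      refine ⟨_, ⟨s, by simpa using hs, rfl⟩, ?_⟩
      rw [Prod.dist_eq]
      simpa [hδ] using hx
    exact (hsub this).2
  set δ' := min δ ρ with hδ'
  have hδ'0 : 0 < δ' := lt_min hδ hρ
  obtain ⟨N, T, hT⟩ := happ r hrR (δ' / 2) (half_pos hδ'0)
  let η : ℂ → (Fin N → ℂ) := fun s j => s ^ (j.1 + 1)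
  have hηd : Differentiable ℂ η := differentiable_pi.2 fun j => by simp only [η]; fun_prop
  obtain ⟨ε, hε, hεT⟩ : ∃ ε > 0, ∀ y : Fin N → ℂ, ‖y‖ ≤ ε → ‖T y‖ < δ' / 2 := by
    have h1 : ∀ᶠ y in 𝓝 (0 : Fin N → ℂ), ‖T y‖ < δ' / 2 := by
      have : ContinuousAt (fun y => ‖T y‖) 0 := by fun_prop
      exact this.eventually (gt_mem_nhds (by simpa using half_pos hδ'0))
    obtain ⟨ε, hε, h⟩ := Metric.eventually_nhds_iff.1 h1
    exact ⟨ε / 2, half_pos hε, fun y hy => h (by rw [dist_zero_right]; linarith)⟩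
  have hclose : ∀ s : ℂ, ‖s‖ ≤ r → ∀ y ∈ closedBall (η s) ε, dist (H 0 + T y) (H s) < δ' := by
    intro s hs y hy
    have h1 := hT s hs
    have h2 := hεT (y - η s) (by rwa [← dist_eq_norm])
    rw [dist_eq_norm]
    have : H 0 + T y - H s = (H 0 + T (η s) - H s) + T (y - η s) := by rw [map_sub]; abel
    rw [this]
    exact (norm_add_le _ _).trans_lt (by linarith)
  have hmem : ∀ s : ℂ, ‖s‖ ≤ r → ∀ y ∈ closedBall (η s) ε, H 0 + T y ∈ B₁ := by
    intro s hs y hy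
    have h1 := hclose s hs y hy
    have h2 := mem_ball.1 (hr s hs).1
    have := dist_triangle (H 0 + T y) (H s) (H 0)
    exact mem_ball.2 (by linarith [min_le_right δ ρ])
  -- The truncation level lies below `P - m`, so truncating does not spoil the boundary inequality.
  obtain ⟨M, hM⟩ : ∃ M : ℕ, ∀ s : ℂ, ‖s‖ ≤ r → -(M : ℝ) ≤ P s - m := by
    obtain ⟨s₀, -, hs₀⟩ := (isCompact_closedBall (0 : ℂ) r).exists_isMinOn
      ⟨0, by simp [hr0.le]⟩ hPc.continuousOn
    obtain ⟨M, hM⟩ := exists_nat_ge (-(P s₀ - m))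
    exact ⟨M, fun s hs => by
      have : P s₀ ≤ P s := hs₀ (show s ∈ closedBall (0 : ℂ) r by simpa using hs)
      linarith⟩
  set w := truncatedPullback u B₁ (H 0) T M
  have hwC : ∀ y, ‖w y‖ ≤ max (M : ℝ) (v₀ + 1) := by
    intro y
    rw [norm_eq_abs, abs_le]
    refine ⟨(neg_le_neg (le_max_left _ _)).trans (neg_le_truncatedPullback hu₁.1 y),
      truncatedPullback_le hu₁.1 ?_ fun hy => ?_⟩
    · exact (neg_nonpos.2 (Nat.cast_nonneg M)).trans ((Nat.cast_nonneg M).trans (le_max_left _ _))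
    · exact (hρB _ hy).2.le.trans (EReal.coe_le_coe_iff.2 (le_max_right _ _))
  obtain ⟨g, hgd, hge, hgsub, hgle⟩ := exists_regularization
    (measurable_truncatedPullback isOpen_ball hu₁) hwC (G := {y | H 0 + T y ∈ B₁})
    (truncatedPullback_le_circleAverage isOpen_ball hu₁ hwC) hε
  have hbdry : ∀ s : ℂ, ‖s‖ = r → g (η s) ≤ P s - m := fun s hs =>
    hgle _ _ fun y hy => truncatedPullback_le hu₁.1 (hM s hs.le) fun _ =>
      (hδu s hs _ ((hclose s hs.le y hy).trans_le (min_le_left _ _))).le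
  have hη0 : η 0 = 0 := by ext j; simp [η]
  have hcent : P 0 ≤ g (η 0) := by
    refine le_trans ?_ (hge _ fun y hy => hmem 0 (by simpa using hr0.le) y hy)
    have hx : H 0 + T (η 0) ∈ B₁ := by simpa [hη0, hB₁] using hρ
    rw [← EReal.coe_le_coe_iff, coe_truncatedPullback hu₁.1 hx]
    refine le_trans ?_ (le_max_left _ _)
    simp [hη0, hv, P]
  have hfc : Continuous fun s => g (η s) - P s := (hgd.continuous.comp hηd.continuous).sub hPc
  -- The maximum of `g ∘ η - P` is interior: the function is at least `0` at the centre and at most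
  -- `-m` on the circle. Hence `P`, up to a constant, touches `g ∘ η` from above at `c`.
  obtain ⟨c, hcr, hcmax⟩ := (isCompact_closedBall (0 : ℂ) r).exists_isMaxOn
    ⟨0, by simp [hr0.le]⟩ hfc.continuousOn
  have hcr' : ‖c‖ < r := by
    refine lt_of_le_of_ne (by simpa using hcr) fun hc => ?_
    have h1 : g (η 0) - P 0 ≤ g (η c) - P c := hcmax (by simp [hr0.le])
    linarith [hbdry c hc]
  -- The new linear coefficient comes from expanding `P` about `c`; the term `-κ / 2 * ‖s‖ ^ 2`
  -- contributes `-κ` times the conjugate of `c`.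
  refine not_touch_of_contDiff hgd hηd (c := c) ?_ (half_pos hκ)
    (α := α + 2 * β * c - κ * (starRingEnd ℂ) c) (β := β) ?_
  · have hσ : 0 < ρ - dist (H c) (H 0) := sub_pos.2 (hr c hcr'.le).1
    have hev : ∀ᶠ t : ℝ in 𝓝[>] 0, t * ‖T (deriv η c)‖ < ρ - dist (H c) (H 0) := by
      have : ContinuousAt (fun t : ℝ => t * ‖T (deriv η c)‖) 0 := by fun_prop
      exact (this.eventually (gt_mem_nhds (by simpa using hσ))).filter_mono nhdsWithin_le_nhds
    filter_upwards [hev, self_mem_nhdsWithin] with t ht ht0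
    refine hgsub _ _ fun ζ hζ y hy => ?_
    set d := ζ • (t : ℂ) • deriv η c
    have h1 := hclose c hcr'.le (y - d) (by
      rw [mem_closedBall, dist_eq_norm] at hy ⊢
      rwa [sub_sub, add_comm d])
    have h2 : ‖T d‖ ≤ t * ‖T (deriv η c)‖ := by
      simp only [d, map_smul, norm_smul, Complex.norm_real, norm_eq_abs, abs_of_pos ht0.out]
      exact mul_le_of_le_one_left (mul_nonneg ht0.out.le (norm_nonneg _)) hζ
    have h3 : dist (H 0 + T y) (H 0 + T (y - d)) = ‖T d‖ := by
      rw [dist_add_left, dist_eq_norm, ← map_sub, sub_sub_cancel]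
    have h4 := dist_triangle4 (H 0 + T y) (H 0 + T (y - d)) (H c) (H 0)
    exact mem_ball.2 (by linarith [min_le_right δ ρ])
  · filter_upwards [isOpen_ball.mem_nhds (mem_ball_zero_iff.2 hcr')] with s hs
    have h1 : g (η s) - P s ≤ g (η c) - P c := hcmax (ball_subset_closedBall hs)
    have h2 : P s - P c = ((α + 2 * β * c - κ * (starRingEnd ℂ) c) * (s - c) +
        β * (s - c) ^ 2).re - κ / 2 * ‖s - c‖ ^ 2 := by
      simp only [P, Complex.sq_norm, Complex.normSq_apply]
      simp only [pow_two, Complex.add_re,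
        Complex.mul_re, Complex.sub_re, Complex.sub_im, Complex.mul_im, Complex.conj_re,
        Complex.conj_im, Complex.ofReal_re, Complex.ofReal_im, Complex.add_im, Complex.re_ofNat,
        Complex.im_ofNat]
      ring
    linarith

end NotTouch

/-! ### A two constants theorem for plurisubharmonic functions -/

section TwoConstants

open Metric Filter

/-- The second-order expansion is `-1 + Re (2t - 2t²) - |t|²`; for small `t`, half of `|t|²` absorbs
the remainder. -/
lemma neg_inv_normSq_one_add_le {t : ℂ} (ht : ‖t‖ ≤ 1 / 100) :
    -(1 / ‖1 + t‖ ^ 2) ≤ -1 + (2 * t - 2 * t ^ 2).re - ‖t‖ ^ 2 / 2 := by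
  have ha : |t.re| ≤ 1 / 100 := (Complex.abs_re_le_norm t).trans ht
  have hb : |t.im| ≤ 1 / 100 := (Complex.abs_im_le_norm t).trans ht
  simp only [Complex.sq_norm, Complex.normSq_apply]
  simp only [pow_two, Complex.add_re, Complex.one_re, Complex.add_im, Complex.one_im,
    Complex.sub_re, Complex.mul_re, Complex.re_ofNat, Complex.im_ofNat, Complex.mul_im]
  set a := t.re
  set b := t.im
  rw [abs_le] at ha hb
  have hpos : 0 < (1 + a) * (1 + a) + (0 + b) * (0 + b) := by nlinarith [mul_self_nonneg b]
  have h1 : a * (3 * a ^ 2 - 5 * b ^ 2) ≤ 5 / 100 * (a ^ 2 + b ^ 2) := by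
    nlinarith [sq_nonneg a, sq_nonneg b, mul_nonneg (sub_nonneg.2 ha.2) (sq_nonneg a),
      mul_nonneg (by linarith [ha.1] : 0 ≤ a + 1 / 100) (sq_nonneg b)]
  have ha2 : a ^ 2 ≤ 1 / 10000 := by nlinarith
  have hb2 : b ^ 2 ≤ 1 / 10000 := by nlinarith
  have h2 : (a ^ 2 + b ^ 2) * (5 / 2 * a ^ 2 - 3 / 2 * b ^ 2) ≤ 1 / 100 * (a ^ 2 + b ^ 2) := by
    nlinarith [sq_nonneg a, sq_nonneg b]
  rw [neg_le, le_div_iff₀ hpos]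
  nlinarith [sq_nonneg a, sq_nonneg b]

/-- The function `-1/|z|²` is strictly superharmonic. -/
lemma eventually_neg_inv_normSq_le {z₀ : ℂ} (hz₀ : z₀ ≠ 0) {κ : ℝ} (hκ : 0 < κ) :
    ∃ (α β : ℂ) (μ : ℝ), 0 < μ ∧ ∀ᶠ s in 𝓝 (0 : ℂ),
      -κ * (1 / ‖z₀ + s‖ ^ 2) ≤
        -κ * (1 / ‖z₀‖ ^ 2) + (α * s + β * s ^ 2).re - μ * ‖s‖ ^ 2 := by
  have hn : 0 < ‖z₀‖ := norm_pos_iff.2 hz₀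
  set k : ℝ := κ / ‖z₀‖ ^ 2 with hk
  have hk0 : 0 < k := by positivity
  -- These are the coefficients of the previous expansion at `t = s / z₀`, multiplied by `k`.
  refine ⟨k * (2 / z₀), -(k * (2 / z₀ ^ 2)), k / (2 * ‖z₀‖ ^ 2), by positivity, ?_⟩
  have hev : ∀ᶠ s in 𝓝 (0 : ℂ), ‖s / z₀‖ < 1 / 100 := by
    have : ContinuousAt (fun s : ℂ => ‖s / z₀‖) 0 := by fun_prop
    exact this.eventually (gt_mem_nhds (by simp))
  filter_upwards [hev] with s hs
  have h := mul_le_mul_of_nonneg_left (neg_inv_normSq_one_add_le hs.le) hk0.le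
  have e1 : k * -(1 / ‖1 + s / z₀‖ ^ 2) = -κ * (1 / ‖z₀ + s‖ ^ 2) := by
    have : z₀ + s = z₀ * (1 + s / z₀) := by field_simp
    rw [this, norm_mul, hk]
    field_simp
  have e2 : k * (2 * (s / z₀) - 2 * (s / z₀) ^ 2).re =
      (k * (2 / z₀) * s + -(k * (2 / z₀ ^ 2)) * s ^ 2).re := by
    rw [← Complex.re_ofReal_mul]
    congr 1
    field_simp
    ring
  rw [e1] at h
  refine h.trans_eq ?_
  rw [mul_sub, mul_add, e2, norm_div, hk]
  field_simp

/-- Comparison on the annulus `δ ≤ |z| ≤ 2` with a strictly superharmonic radial barrier `q`. A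
positive maximum of `v - q` cannot lie on the boundary, and at an interior one `q` plus a constant
would touch `v` from above. -/
lemma le_of_not_touch {v : ℂ → EReal} (husc : UpperSemicontinuousOn v (closedBall 0 2))
    (hneg : ∀ z ∈ closedBall (0 : ℂ) 2, v z < 0)
    (hnt : ∀ c ∈ ball (0 : ℂ) 2, ∀ (v₀ : ℝ) (α β : ℂ) (μ : ℝ), 0 < μ → v c = v₀ →
      ¬ ∀ᶠ s in 𝓝 (0 : ℂ), v (c + s) ≤ ((v₀ + (α * s + β * s ^ 2).re - μ * ‖s‖ ^ 2 : ℝ) : EReal))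
    {a δ : ℝ} (ha : a < 0) (hδ : 0 < δ) (hδ1 : δ < 1) (hle : ∀ z ∈ closedBall (0 : ℂ) δ, v z ≤ a) :
    v 1 ≤ ((a / (1 / δ ^ 2 - 1 / 4) * (3 / 4) : ℝ) : EReal) := by
  have hD : 3 / 4 < 1 / δ ^ 2 - 1 / 4 := by
    have : 1 < 1 / δ ^ 2 := by rw [lt_div_iff₀ (by positivity)]; nlinarith
    linarith
  set κ := -a / (1 / δ ^ 2 - 1 / 4) with hκ
  have hκ0 : 0 < κ := div_pos (by linarith) (by linarith)
  -- `q` is `0` on `|z| = 2` and `a` on `|z| = δ`; its value at `1` is the bound claimed.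
  let q : ℂ → ℝ := fun z => -κ * (1 / ‖z‖ ^ 2) + κ / 4
  let K : Set ℂ := closedBall 0 2 \ ball 0 δ
  have hKc : IsCompact K := (isCompact_closedBall _ _).diff isOpen_ball
  have hK : ∀ z ∈ K, δ ≤ ‖z‖ ∧ ‖z‖ ≤ 2 := fun z hz => by
    have h1 := hz.1
    have h2 := hz.2
    simp only [mem_closedBall_zero_iff] at h1
    simp only [mem_ball_zero_iff, not_lt] at h2
    exact ⟨h2, h1⟩
  have hqc : ContinuousOn (fun z => ((-q z : ℝ) : EReal)) K := by
    refine continuous_coe_real_ereal.comp_continuousOn ?_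
    have : ContinuousOn (fun z : ℂ => 1 / ‖z‖ ^ 2) K := by
      refine continuousOn_const.div (by fun_prop) fun z hz => ?_
      exact pow_ne_zero _ (hδ.trans_le (hK z hz).1).ne'
    exact ((continuousOn_const.mul this).add continuousOn_const).neg
  have hF : UpperSemicontinuousOn (fun z => v z + ((-q z : ℝ) : EReal)) K := by
    refine UpperSemicontinuousOn.add' (husc.mono Set.sdiff_subset) hqc.upperSemicontinuousOn
      fun z hz => EReal.continuousAt_add ?_ ?_
    · exact Or.inl ((hneg z hz.1).trans EReal.zero_lt_top).ne
    · exact Or.inr (EReal.coe_ne_top _)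
  have h1K : (1 : ℂ) ∈ K := ⟨by simp, by simpa using hδ1.le⟩
  obtain ⟨c, hcK, hmax⟩ := hF.exists_isMaxOn ⟨1, h1K⟩ hKc
  have hq1 : q 1 = a / (1 / δ ^ 2 - 1 / 4) * (3 / 4) := by
    simp only [q, norm_one, hκ]; ring
  rw [← hq1]
  by_contra! hlt
  have hpos : ∀ x : EReal, ∀ t : ℝ, 0 < x + ((-t : ℝ) : EReal) ↔ (t : EReal) < x := by
    intro x t
    induction x with
    | bot => simp
    | top => simp
    | coe x =>
      rw [← EReal.coe_add, ← EReal.coe_zero, EReal.coe_lt_coe_iff, EReal.coe_lt_coe_iff]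
      constructor <;> intro h <;> linarith
  have hcq : (q c : EReal) < v c := (hpos _ _).1 (((hpos _ _).2 hlt).trans_le (hmax h1K))
  obtain ⟨hc1, hc2⟩ := hK c hcK
  have hcδ : δ < ‖c‖ := by
    refine lt_of_le_of_ne hc1 fun h => ?_
    have h1 := hcq.trans_le (hle c (by simp [h]))
    rw [EReal.coe_lt_coe_iff] at h1
    have : q c = a := by
      have hD' : (1 / δ ^ 2 - 1 / 4) ≠ 0 := by linarith
      have h2 : q c = -κ * (1 / δ ^ 2 - 1 / 4) := by simp only [q, ← h]; ring
      rw [h2, hκ, neg_mul, div_mul_cancel₀ _ hD', neg_neg]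
    linarith
  have hc2' : ‖c‖ < 2 := by
    refine lt_of_le_of_ne hc2 fun h => ?_
    have h1 := hcq.trans (hneg c hcK.1)
    rw [← EReal.coe_zero, EReal.coe_lt_coe_iff] at h1
    have : q c = 0 := by simp only [q, h]; ring
    linarith
  have hvc : ((v c).toReal : EReal) = v c :=
    EReal.coe_toReal ((hneg c hcK.1).trans EReal.zero_lt_top).ne ((EReal.bot_lt_coe _).trans hcq).ne'
  set v₀ := (v c).toReal
  have hc0 : c ≠ 0 := norm_pos_iff.1 (hδ.trans hcδ)
  obtain ⟨α, β, μ, hμ, hev⟩ := eventually_neg_inv_normSq_le hc0 hκ0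
  refine hnt c (by simpa using hc2') v₀ α β μ hμ hvc.symm ?_
  have hnb : ∀ᶠ s in 𝓝 (0 : ℂ), δ < ‖c + s‖ ∧ ‖c + s‖ < 2 := by
    have : ContinuousAt (fun s : ℂ => ‖c + s‖) 0 := by fun_prop
    exact (this.eventually (lt_mem_nhds (by simpa using hcδ))).and
      (this.eventually (gt_mem_nhds (by simpa using hc2')))
  filter_upwards [hev, hnb] with s hs hsn
  have hsK : c + s ∈ K := ⟨by simpa using hsn.2.le, by simpa using hsn.1.le⟩
  have h1 : v (c + s) + ((-q (c + s) : ℝ) : EReal) ≤ v c + ((-q c : ℝ) : EReal) := hmax hsK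
  rw [← hvc, ← EReal.coe_add] at h1
  have h2 : v (c + s) ≤ ((v₀ + -q c + q (c + s) : ℝ) : EReal) := by
    have h3 := hneg _ hsK.1
    revert h1 h3
    generalize v (c + s) = x
    intro h1 h3
    induction x with
    | bot => exact bot_le
    | top => exact absurd h3 (by simp)
    | coe x =>
      rw [← EReal.coe_add, EReal.coe_le_coe_iff] at h1
      rw [EReal.coe_le_coe_iff]
      linarith
  refine h2.trans (EReal.coe_le_coe_iff.2 ?_)
  simp only [q]
  linarith

variable {E X : Type*} [NormedAddCommGroup E] [NormedSpace ℂ E]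
  [TopologicalSpace X] [ChartedSpace E X] {φ : X → EReal}

lemma IsPlurisubharmonic.upperSemicontinuous (hφ : IsPlurisubharmonic E φ) :
    UpperSemicontinuous φ := by
  intro a y hy
  obtain ⟨e, he, ha, c, r, ht, hpsh⟩ := hφ a
  have h1 := hpsh.2.1 (e a) (e.map_source ha) y (by simpa [e.left_inv ha] using hy)
  rw [e.open_target.nhdsWithin_eq (e.map_source ha)] at h1
  filter_upwards [(e.continuousAt ha).eventually h1, e.open_source.mem_nhds ha] with x hx hxs
  simpa [e.left_inv hxs] using hx

variable [CompleteSpace E]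

lemma IsPlurisubharmonic.not_touch (hφ : IsPlurisubharmonic E φ) {h : ℂ → X} {c : ℂ}
    (hh : ∀ᶠ s in 𝓝 c, MDifferentiableAt 𝓘(ℂ, ℂ) 𝓘(ℂ, E) h s) {v₀ : ℝ} (hv : φ (h c) = v₀)
    {α β : ℂ} {μ : ℝ} (hμ : 0 < μ)
    (htouch : ∀ᶠ s in 𝓝 (0 : ℂ), φ (h (c + s)) ≤
      ((v₀ + (α * s + β * s ^ 2).re - μ * ‖s‖ ^ 2 : ℝ) : EReal)) : False := by
  obtain ⟨e, he, ha, -, -, -, hpsh⟩ := hφ (h c)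
  have hcont : ContinuousAt h c := hh.self_of_nhds.continuousAt
  have htr : Tendsto (fun s : ℂ => c + s) (𝓝 0) (𝓝 c) := by
    have : ContinuousAt (fun s : ℂ => c + s) 0 := by fun_prop
    simpa [ContinuousAt] using this
  have hsrc : ∀ᶠ s in 𝓝 (0 : ℂ), h (c + s) ∈ e.source :=
    htr.eventually (hcont.eventually (e.open_source.mem_nhds ha))
  refine hpsh.not_touch e.open_target (H := fun s => e (h (c + s))) (v₀ := v₀) ?_ ?_ ?_ hμ
    (α := α) (β := β) ?_
  · filter_upwards [hsrc, htr.eventually hh] with s hs hd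
    have h1 : MDifferentiableAt 𝓘(ℂ, E) 𝓘(ℂ, E) e (h (c + s)) :=
      mdifferentiableAt_of_mem_maximalAtlas
        (IsManifold.maximalAtlas_subset_of_le (by exact le_top) he) hs
    have h2 : MDifferentiableAt 𝓘(ℂ, ℂ) 𝓘(ℂ, E) (e ∘ h) (c + s) := h1.comp _ hd
    rw [mdifferentiableAt_iff_differentiableAt] at h2
    exact h2.comp s (f := fun s => c + s) (by fun_prop)
  · simpa using e.map_source ha
  · simpa [e.left_inv ha] using hv
  · filter_upwards [hsrc, htouch] with s hs hd
    rwa [e.left_inv hs]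

/-- If a negative plurisubharmonic function is at most `a` on the centre of a disk, then it is
at most a negative constant depending only on `a` and the relative sizes. -/
lemma IsPlurisubharmonic.le_of_forall_closedBall (hφ : IsPlurisubharmonic E φ)
    (hneg : ∀ x, φ x < 0) {h : ℂ → X} {R : ℝ} (hR : 2 < R)
    (hh : MDifferentiableOn 𝓘(ℂ, ℂ) 𝓘(ℂ, E) h (ball 0 R))
    {a δ : ℝ} (ha : a < 0) (hδ : 0 < δ) (hδ1 : δ < 1)
    (hle : ∀ z ∈ closedBall (0 : ℂ) δ, φ (h z) ≤ a) :
    φ (h 1) ≤ ((a / (1 / δ ^ 2 - 1 / 4) * (3 / 4) : ℝ) : EReal) := by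
  refine le_of_not_touch (v := fun z => φ (h z)) ?_ (fun z _ => hneg _) ?_ ha hδ hδ1 hle
  · intro z hz y hy
    have hzR : z ∈ ball (0 : ℂ) R := closedBall_subset_ball hR hz
    have h1 := (hh.continuousOn.continuousAt (isOpen_ball.mem_nhds hzR)).eventually
      (hφ.upperSemicontinuous (h z) y hy)
    exact h1.filter_mono nhdsWithin_le_nhds
  · intro c hc v₀ α β μ hμ hv htouch
    refine hφ.not_touch ?_ hv hμ htouch
    have hcR : c ∈ ball (0 : ℂ) R := ball_subset_ball hR.le hc
    filter_upwards [isOpen_ball.mem_nhds hcR] with s hs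
    exact (hh s hs).mdifferentiableAt (isOpen_ball.mem_nhds hs)

end TwoConstants

/-! ### Identity theorem -/

section Identity

open Metric Filter

variable {F A : Type*} [NormedAddCommGroup F] [NormedSpace ℂ F]
  [TopologicalSpace A] [ChartedSpace F A] [IsManifold 𝓘(ℂ, F) ω A]

/-- The points near which `f` vanishes form an open set. It is closed in `U`: in a chart ball that
meets it at `y`, restrict `f` to the complex line through `y` and any `z`, and use the one-variable
identity theorem. -/
lemma eq_zero_of_mdifferentiableOn_of_eventually {U : Set A} (hU : IsOpen U)
    (hUc : IsPreconnected U) {f : A → ℂ} (hf : MDifferentiableOn 𝓘(ℂ, F) 𝓘(ℂ, ℂ) f U)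
    {p : A} (hp : p ∈ U) (h0 : ∀ᶠ x in 𝓝 p, f x = 0) : ∀ x ∈ U, f x = 0 := by
  let S : Set A := {x | ∀ᶠ y in 𝓝 x, f y = 0}
  have hS : IsOpen S := isOpen_iff_mem_nhds.2 fun x hx => eventually_eventually_nhds.2 hx
  have hsub : U ⊆ S := by
    refine hUc.subset_of_closure_inter_subset hS ⟨p, hp, h0⟩ ?_
    rintro x ⟨hxS, hxU⟩
    set e := chartAt F x
    have hxe : x ∈ e.source := mem_chart_source F x
    have hopen : IsOpen (e.target ∩ e.symm ⁻¹' U) := e.symm.isOpen_inter_preimage hU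
    obtain ⟨r, hr, hball⟩ := Metric.isOpen_iff.1 hopen (e x)
      ⟨e.map_source hxe, by simpa [e.left_inv hxe] using hxU⟩
    have hNo : IsOpen (e.source ∩ e ⁻¹' ball (e x) r) := e.isOpen_inter_preimage isOpen_ball
    obtain ⟨y, ⟨hye, hyr⟩, hyS⟩ := mem_closure_iff.1 hxS _ hNo ⟨hxe, mem_ball_self hr⟩
    filter_upwards [hNo.mem_nhds ⟨hxe, mem_ball_self hr⟩] with z hz
    set l : ℂ → F := fun ζ => e y + ζ • (e z - e y) with hl
    have hlc : Continuous l := by fun_prop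
    set D : Set ℂ := l ⁻¹' ball (e x) r with hD
    have hDo : IsOpen D := isOpen_ball.preimage hlc
    have hDc : IsPreconnected D := by
      refine Convex.isPreconnected fun a ha b hb s t hs ht hst => ?_
      have hcomb : l (s • a + t • b) = s • l a + t • l b := by
        have h1 : e y = (s + t) • e y := by rw [hst, one_smul]
        simp only [hl, smul_add, add_smul, smul_assoc] at h1 ⊢
        nth_rewrite 1 [h1]
        abel
      change l (s • a + t • b) ∈ ball (e x) r
      rw [hcomb]
      exact convex_ball _ _ ha hb hs ht hst
    have h0D : (0 : ℂ) ∈ D := by simpa [hD, hl] using hyr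
    have h1D : (1 : ℂ) ∈ D := by simpa [hD, hl] using hz.2
    have hdiff : DifferentiableOn ℂ (f ∘ e.symm ∘ l) D := by
      rw [← mdifferentiableOn_iff_differentiableOn]
      refine hf.comp (u := U) ((mdifferentiableOn_atlas_symm (chart_mem_atlas F x)).comp
        (mdifferentiableOn_iff_differentiableOn.2 (by fun_prop)) fun ζ hζ => (hball hζ).1)
        fun ζ hζ => (hball hζ).2
    have hev : (f ∘ e.symm ∘ l) =ᶠ[𝓝 0] 0 := by
      have hl0 : l 0 = e y := by simp [hl]
      have ht : Tendsto (e.symm ∘ l) (𝓝 0) (𝓝 y) := by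
        have h2 := e.tendsto_symm hye
        rw [← hl0] at h2
        exact h2.comp (hlc.tendsto 0)
      exact ht.eventually hyS
    have := (hdiff.analyticOnNhd hDo).eqOn_zero_of_preconnected_of_eventuallyEq_zero hDc h0D hev h1D
    simpa [hl, e.left_inv hz.1] using this
  exact fun x hx => (hsub hx).self_of_nhds

lemma mem_uniquenessPoints_of_isOpen {S : Set A} (hS : IsOpen S) {p : A} (hp : p ∈ S) :
    p ∈ uniquenessPoints F S := by
  refine ⟨subset_closure hp, fun U hU hUc hpU f hf h0 => ?_⟩
  refine eq_zero_of_mdifferentiableOn_of_eventually hU hUc.isPreconnected hf hpU ?_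
  filter_upwards [hU.mem_nhds hpU, hS.mem_nhds hp] with x h1 h2 using h0 x ⟨h1, h2⟩

end Identity

/-! ### The equivalence -/

section Main

open Metric Filter

lemma HasWVP.hasQuasiWVP {E : Type u} {X : Type v} [NormedAddCommGroup E] [NormedSpace ℂ E]
    [TopologicalSpace X] [ChartedSpace E X] (h : HasWVP.{w} E X) (Ω T : Set X) :
    HasQuasiWVP.{w} E Ω T := by
  intro F A _ _ _ _ _ _ _ f _ ⟨z, hz, hzu⟩
  have hsub : convergenceSet (fun k => ⇑(f k).1) T ⊆
      convergenceSet (fun k => ⇑(f k).1) Set.univ := fun a ⟨x, _, hx⟩ => ⟨x, trivial, hx⟩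
  exact h F A f ⟨z, hsub hz, uniquenessPoints_mono hsub hzu⟩

variable {E : Type u} {X : Type v} [NormedAddCommGroup E] [NormedSpace ℂ E]
  [TopologicalSpace X] [ChartedSpace E X]

/-- The local form of QWVP: it is applied to `V` as a manifold, after dropping the finitely many
maps that may leave `Ω`. -/
lemma HasQuasiWVP.exists_limit {Ω T : Set X} (h : HasQuasiWVP.{w} E Ω T) {F A : Type w}
    [NormedAddCommGroup F] [NormedSpace ℂ F] [CompleteSpace F]
    [TopologicalSpace A] [ChartedSpace F A] [IsManifold 𝓘(ℂ, F) ω A] {f : ℕ → A → X}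
    (hf : ∀ k, MDifferentiable 𝓘(ℂ, F) 𝓘(ℂ, E) (f k)) {V : TopologicalSpace.Opens A}
    (hV : IsConnected (V : Set A)) (hΩ : ∀ᶠ k in atTop, ∀ a ∈ V, f k a ∈ Ω) {S : Set A} {p : A}
    (hpV : p ∈ V) (hpS : p ∈ S) (hpu : p ∈ uniquenessPoints F S)
    (hS : ∀ a ∈ S, a ∈ V → a ∈ convergenceSet f T) :
    ∃ G : Hol F E V X, ∀ a : V, Tendsto (fun k => f k a) atTop (𝓝 (G.1 a)) := by
  obtain ⟨K, hK⟩ := eventually_atTop.1 hΩ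
  have : ConnectedSpace V := Subtype.connectedSpace hV
  have hmd : ∀ k, MDifferentiable 𝓘(ℂ, F) 𝓘(ℂ, E) (fun a : V => f k a) := fun k a =>
    mdifferentiableAt_opens_iff.2 (hf k a)
  let g : ℕ → Hol F E V X := fun k => ⟨⟨_, (hmd (k + K)).continuous⟩, hmd (k + K)⟩
  have hsub : ((↑) ⁻¹' S : Set V) ⊆ convergenceSet (fun k => ⇑(g k).1) T := by
    intro a ha
    obtain ⟨x, hx, hlim⟩ := hS a ha a.2
    exact ⟨x, hx, hlim.comp (tendsto_add_atTop_nat K)⟩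
  obtain ⟨G, hG⟩ := h F V g (fun k a => hK _ (Nat.le_add_left K k) a a.2)
    ⟨⟨p, hpV⟩, hsub hpS, uniquenessPoints_mono hsub (mem_uniquenessPoints_opens hpu)⟩
  refine ⟨G, fun a => ?_⟩
  have h1 := ((continuous_eval_const (F := C(V, X)) a).tendsto _).comp
    ((continuous_subtype_val.tendsto G).comp hG)
  exact (tendsto_add_atTop_iff_nat K).1 h1

/-- Equicontinuity upgrades pointwise convergence: each point of a compact set has a neighbourhood
that almost all maps send into `U`, and finitely many of these suffice. -/
lemma tendsto_hol_of_forall_tendsto [IsManifold 𝓘(ℂ, E) ω X] (hX : IsHyperbolic E X)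
    {F A : Type*} [NormedAddCommGroup F] [NormedSpace ℂ F]
    [TopologicalSpace A] [ChartedSpace F A] [IsManifold 𝓘(ℂ, F) ω A]
    (f : ℕ → Hol F E A X) (g : Hol F E A X)
    (h : ∀ a, Tendsto (fun k => (f k).1 a) atTop (𝓝 (g.1 a))) : Tendsto f atTop (𝓝 g) := by
  rw [tendsto_subtype_rng, ContinuousMap.tendsto_nhds_compactOpen]
  intro K hK U hU hKU
  have hloc : ∀ a ∈ K, ∃ W ∈ 𝓝 a, ∀ᶠ k in atTop, ∀ b ∈ W, (f k).1 b ∈ U := by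
    intro a ha
    obtain ⟨W, hW, h1, -⟩ := hX.exists_nhds_eventually_mem (fun k => (f k).2) (h a) hU (hKU ha)
    exact ⟨W, hW, h1⟩
  refine hK.induction_on (p := fun s => ∀ᶠ k in atTop, Set.MapsTo (f k).1 s U) ?_ ?_ ?_ ?_
  · exact .of_forall fun k => Set.mapsTo_empty _ _
  · exact fun s t hst ht => ht.mono fun k hk => hk.mono_left hst
  · exact fun s t hs ht => (hs.and ht).mono fun k hk => hk.1.union hk.2
  · intro a ha
    obtain ⟨W, hW, h1⟩ := hloc a ha
    exact ⟨W, mem_nhdsWithin_of_mem_nhds hW, h1⟩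

lemma exists_isConnected_opens_subset {F A : Type*} [NormedAddCommGroup F] [NormedSpace ℂ F]
    [TopologicalSpace A] [ChartedSpace F A] (a : A) {W : Set A} (hW : W ∈ 𝓝 a) :
    ∃ V : TopologicalSpace.Opens A, IsConnected (V : Set A) ∧ a ∈ V ∧ (V : Set A) ⊆ W := by
  have : LocallyConnectedSpace A := ChartedSpace.locallyConnectedSpace F A
  obtain ⟨V, hVW, hV, haV, hVc⟩ := locallyConnectedSpace_iff_subsets_isOpen_isConnected.1 this a W hW
  exact ⟨⟨V, hV⟩, hVc, haV, hVW⟩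

/-- The sets `T c` cover both readings of convergence: equicontinuity already puts the limits used
here in a sublevel set, so any `T c` that contains it will do. -/
theorem hasWVP_of_hasQuasiWVP [CompleteSpace E] [IsManifold 𝓘(ℂ, E) ω X] {φ : X → EReal}
    (hφ : IsPlurisubharmonic E φ) (hneg : ∀ x, φ x < 0) (hX : IsHyperbolic E X)
    {T : ℝ → Set X} (hT : ∀ c : ℝ, {x | φ x < (c : EReal)} ⊆ T c)
    (hQ : ∀ c : ℝ, c < 0 → HasQuasiWVP.{w} E {x : X | φ x < (c : EReal)} (T c)) :
    HasWVP.{w} E X := by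
  intro F A _ _ _ _ _ _ _ f ⟨a₀, ha₀, ha₀u⟩
  have := hX.t2Space
  have hf : ∀ k, MDifferentiable 𝓘(ℂ, F) 𝓘(ℂ, E) (f k).1 := fun k => (f k).2
  set f' : ℕ → A → X := fun k => ⇑(f k).1 with hf'
  set Z := convergenceSet f' Set.univ with hZ
  have hopen : ∀ c : ℝ, IsOpen {x | φ x < (c : EReal)} := fun c =>
    hφ.upperSemicontinuous.isOpen_preimage c
  have hlocal : ∀ a ∈ Z, ∃ c : ℝ, c < 0 ∧ ∃ W ∈ 𝓝 a,
      (∀ᶠ k in atTop, ∀ b ∈ W, φ (f' k b) < (c : EReal)) ∧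
      ∀ b ∈ W, b ∈ Z → b ∈ convergenceSet f' {x | φ x < (c : EReal)} := by
    rintro a ⟨x, -, hx⟩
    obtain ⟨c, hc1, hc2⟩ := EReal.lt_iff_exists_real_btwn.1 (hneg x)
    obtain ⟨W, hW, h1, h2⟩ := hX.exists_nhds_eventually_mem hf hx (hopen c) hc1
    exact ⟨c, by exact_mod_cast hc2, W, hW, h1, fun b hb ⟨y, _, hy⟩ => ⟨y, h2 b hb y hy, hy⟩⟩
  have hmono : ∀ {a : A} {S S' : Set X}, S ⊆ S' → a ∈ convergenceSet f' S →
      a ∈ convergenceSet f' S' := fun h ⟨x, hx, hlim⟩ => ⟨x, h hx, hlim⟩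
  have hnear : ∀ a ∈ Z, a ∈ uniquenessPoints F Z → ∃ V : TopologicalSpace.Opens A, a ∈ V ∧
      ∃ G : Hol F E V X, ∀ b : V, Tendsto (fun k => f' k b) atTop (𝓝 (G.1 b)) := by
    intro a ha hau
    obtain ⟨c, hc, W, hW, h1, h2⟩ := hlocal a ha
    obtain ⟨V, hVc, haV, hVW⟩ := exists_isConnected_opens_subset (F := F) a hW
    exact ⟨V, haV, (hQ c hc).exists_limit hf hVc (h1.mono fun k hk b hb => hk b (hVW hb)) haV
      ha hau fun b hbZ hbV => hmono (hT c) (h2 b (hVW hbV) hbZ)⟩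
  have hint : ∀ {V : TopologicalSpace.Opens A} {a : A}, a ∈ V → (∃ G : Hol F E V X, ∀ b : V,
      Tendsto (fun k => f' k b) atTop (𝓝 (G.1 b))) → a ∈ interior Z := by
    rintro V a haV ⟨G, hG⟩
    exact mem_interior.2 ⟨V, fun b hb => ⟨_, trivial, hG ⟨b, hb⟩⟩, V.2, haV⟩
  -- The propagation step: a bound near one point `p` of convergence must be carried to a
  -- neighbourhood `V` of `a`, uniformly in `k`.
  have hclosed : closure (interior Z) ⊆ interior Z := by
    intro a ha
    set e := chartAt F a
    have hae : a ∈ e.source := mem_chart_source F a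
    obtain ⟨R, hR, hball⟩ := Metric.isOpen_iff.1 e.open_target _ (mem_chart_target F a)
    have hsub8 : ball (e a) (R / 8) ⊆ e.target :=
      (ball_subset_ball (by linarith)).trans hball
    let V : TopologicalSpace.Opens A :=
      ⟨e.source ∩ e ⁻¹' ball (e a) (R / 8), e.isOpen_inter_preimage isOpen_ball⟩
    have haV : a ∈ V := ⟨hae, mem_ball_self (by positivity)⟩
    have hVc : IsConnected (V : Set A) := by
      refine ⟨⟨a, haV⟩, ?_⟩
      change IsPreconnected (e.source ∩ e ⁻¹' ball (e a) (R / 8))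
      rw [← e.symm_image_eq_source_inter_preimage hsub8]
      exact (convex_ball (e a) (R / 8)).isPreconnected.image _
        (e.continuousOn_symm.mono hsub8)
    obtain ⟨p, hpV, hpZ⟩ := mem_closure_iff.1 ha V V.2 haV
    obtain ⟨c, hc, W, hW, h1, h2⟩ := hlocal p (interior_subset hpZ)
    obtain ⟨ρ, hρ, hρW⟩ := Metric.eventually_nhds_iff.1
      ((e.tendsto_symm hpV.1).eventually_mem hW)
    -- For `b` in `V` the disk `l` has `l 0 = e p` and `l 1 = e b`, with `‖e b - e p‖ < R / 4`. So
    -- `‖ζ‖ ≤ ρ / R` moves by less than `ρ` and stays in `W`, while `‖ζ‖ < 5 / 2` stays within `R /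
    -- 8 + 5 * R / 8 < R` of `e a`.
    set δ := min (1 / 2) (ρ / R) with hδ
    have hδ0 : 0 < δ := by positivity
    have hδ1 : δ < 1 := (min_le_left _ _).trans_lt (by norm_num)
    have hD : 3 / 4 < 1 / δ ^ 2 - 1 / 4 := by
      have : 1 < 1 / δ ^ 2 := by rw [lt_div_iff₀ (by positivity)]; nlinarith
      linarith
    set c₁ := c / (1 / δ ^ 2 - 1 / 4) * (3 / 4) with hc₁
    have hc₁0 : c₁ < 0 := mul_neg_of_neg_of_pos (div_neg_of_neg_of_pos hc (by linarith)) (by norm_num)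
    -- Halving `c₁` makes the inequality strict; the maximum with `c` makes the new sublevel set
    -- contain the old one, where the limits near `p` lie.
    set c₂ := max c (c₁ / 2) with hc₂
    have hc₂0 : c₂ < 0 := max_lt hc (by linarith)
    have hbound : ∀ᶠ k in atTop, ∀ b ∈ V, f' k b ∈ {x | φ x < (c₂ : EReal)} := by
      filter_upwards [h1] with k hk b hb
      set l : ℂ → F := fun ζ => e p + ζ • (e b - e p) with hl
      have hp8 : ‖e p - e a‖ < R / 8 := by rw [← dist_eq_norm]; exact hpV.2
      have hb8 : ‖e b - e a‖ < R / 8 := by rw [← dist_eq_norm]; exact hb.2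
      have hbp : ‖e b - e p‖ < R / 4 := by
        have := norm_sub_le_norm_sub_add_norm_sub (e b) (e a) (e p)
        rw [norm_sub_rev (e a)] at this
        linarith
      have hmaps : ∀ ζ ∈ ball (0 : ℂ) (5 / 2), l ζ ∈ e.target := by
        intro ζ hζ
        apply hball
        rw [mem_ball_zero_iff] at hζ
        have h3 : ‖ζ • (e b - e p)‖ ≤ 5 / 2 * (R / 4) := by
          rw [norm_smul]; gcongr
        have h4 : l ζ - e a = (e p - e a) + ζ • (e b - e p) := by simp only [hl]; abel
        rw [mem_ball, dist_eq_norm, h4]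
        linarith [norm_add_le (e p - e a) (ζ • (e b - e p))]
      have hmd : MDifferentiableOn 𝓘(ℂ, ℂ) 𝓘(ℂ, E) (f' k ∘ e.symm ∘ l) (ball 0 (5 / 2)) :=
        (hf k).comp_mdifferentiableOn ((mdifferentiableOn_atlas_symm (chart_mem_atlas F a)).comp
          (mdifferentiableOn_iff_differentiableOn.2 (by fun_prop)) hmaps)
      have hsmall : ∀ ζ ∈ closedBall (0 : ℂ) δ, φ ((f' k ∘ e.symm ∘ l) ζ) ≤ (c : EReal) := by
        intro ζ hζ
        refine (hk _ (hρW ?_)).le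
        rw [mem_closedBall_zero_iff] at hζ
        simp only [hl, dist_self_add_left, norm_smul]
        calc ‖ζ‖ * ‖e b - e p‖ ≤ ρ / R * (R / 4) :=
              mul_le_mul (hζ.trans (min_le_right _ _)) hbp.le (norm_nonneg _) (by positivity)
          _ < ρ := by field_simp; norm_num
      have hle := hφ.le_of_forall_closedBall hneg (by norm_num) hmd hc hδ0 hδ1 hsmall
      have hl1 : (f' k ∘ e.symm ∘ l) 1 = f' k b := by simp [hl, e.left_inv hb.1]
      rw [hl1] at hle
      refine hle.trans_lt (EReal.coe_lt_coe_iff.2 ?_)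
      exact lt_of_lt_of_le (by linarith) (le_max_right _ _)
    -- This set is open, so `p` is a uniqueness point of it by the identity theorem.
    have hpS : p ∈ interior Z ∩ interior W := ⟨hpZ, mem_interior_iff_mem_nhds.2 hW⟩
    refine hint haV ((hQ c₂ hc₂0).exists_limit hf hVc hbound hpV hpS
      (mem_uniquenessPoints_of_isOpen (isOpen_interior.inter isOpen_interior) hpS)
      fun b hb _ => hmono ?_ (h2 b (interior_subset hb.2) (interior_subset hb.1)))
    exact fun x hx => hT c₂ (lt_of_lt_of_le hx (EReal.coe_le_coe_iff.2 (le_max_left _ _)))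
  have hall : ∀ a, a ∈ Z := by
    have h1 : Set.univ ⊆ interior Z := by
      obtain ⟨V, hV, hG⟩ := hnear a₀ ha₀ ha₀u
      exact isPreconnected_univ.subset_of_closure_inter_subset isOpen_interior
        ⟨a₀, trivial, hint hV hG⟩ (Set.inter_subset_left.trans hclosed)
    exact fun a => interior_subset (h1 trivial)
  choose g _ hg using hall
  have hgd : MDifferentiable 𝓘(ℂ, F) 𝓘(ℂ, E) g := by
    intro a
    have hZu : Z = Set.univ := Set.eq_univ_of_forall fun a => ⟨g a, trivial, hg a⟩
    obtain ⟨V, haV, G, hG⟩ := hnear a ⟨g a, trivial, hg a⟩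
      (mem_uniquenessPoints_of_isOpen (hZu ▸ isOpen_univ) ⟨g a, trivial, hg a⟩)
    have hGg : (fun b : V => g b) = G.1 := by
      funext b
      exact tendsto_nhds_unique (hg b) (hG b)
    refine (mdifferentiableAt_opens_iff (x := ⟨a, haV⟩)).1 ?_
    rw [hGg]
    exact G.2 _
  exact ⟨⟨⟨g, hgd.continuous⟩, hgd⟩, tendsto_hol_of_forall_tendsto hX f _ hg⟩

end Main

/-- The two equivalences correspond to the two readings of pointwise convergence of a sequence of
maps into a sublevel set: convergence in the sublevel set, and convergence in `X`. -/
theorem theorem4p1 {E : Type u} {X : Type v}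
    [NormedAddCommGroup E] [NormedSpace ℂ E] [CompleteSpace E]
    [TopologicalSpace X] [ChartedSpace E X] [IsManifold 𝓘(ℂ, E) ω X] [ConnectedSpace X]
    (φ : X → EReal) (hφ : IsPlurisubharmonic E φ) (hneg : ∀ x, φ x < 0) :
    ((IsHyperbolic E X ∧ ∀ c : ℝ, c < 0 →
        HasQuasiWVP.{w} E {x : X | φ x < (c : EReal)} {x : X | φ x < (c : EReal)}) ↔
      HasWVP.{w} E X) ∧
    ((IsHyperbolic E X ∧ ∀ c : ℝ, c < 0 →
        HasQuasiWVP.{w} E {x : X | φ x < (c : EReal)} Set.univ) ↔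
      HasWVP.{w} E X) :=
  ⟨⟨fun h => hasWVP_of_hasQuasiWVP hφ hneg h.1 (fun _ => subset_rfl) h.2,
      fun h => ⟨h.isHyperbolic, fun _ _ => h.hasQuasiWVP _ _⟩⟩,
    ⟨fun h => hasWVP_of_hasQuasiWVP hφ hneg h.1 (T := fun _ => Set.univ)
      (fun _ => Set.subset_univ _) h.2,
      fun h => ⟨h.isHyperbolic, fun _ _ => h.hasQuasiWVP _ _⟩⟩⟩
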